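/- Let $n,p\in\mathbb{N}$ and let $q_\gamma\in\mathbb{N}$ for each $\gamma\in\mathbb{Z}_2^n\setminus\{0\}$. A degree $\gamma\in\mathbb{Z}_2^n$ is called odd (even) if the sum of its components is $1$ ($0$) in $\mathbb{Z}_2$, and $\langle-,-\rangle$ is the standard scalar product of $\mathbb{Z}_2^n$. The domain $\mathbb{R}^{p|\mathbf q}$ is $\mathbb{R}^p$ with the sheaf $V\mapsto C^\infty(V)[[\xi]]$ of formal power series in formal coordinates $\xi^a$, of which $q_\gamma$ have degree $\gamma$, subject to $\xi^a\xi^b=(-1)^{\langle\deg\xi^a,\deg\xi^b\rangle}\xi^b\xi^a$. Let $\mathcal{M}=(M,\mathcal{O}_M)$ be a $\mathbb{Z}_2^n$-manifold of dimension $p|\mathbf q$: a second-countable Hausdorff space $M$ with a sheaf $\mathcal{O}_M$ of $\mathbb{Z}_2^n$-graded $\mathbb{Z}_2^n$-commutative associative unital $\mathbb{R}$-algebras whose stalks are local graded rings, locally isomorphic to $\mathbb{R}^{p|\mathbf q}$. For $U\subset M$ open, let $\mathcal{D}^{-1}(U)=\{0\}$ and, for $k\in\mathbb{N}$, $$\mathcal{D}^k(U)=\{D\in\operatorname{End}_{\mathbb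 R}(\mathcal{O}_M(U)) : [D,f]\in\mathcal{D}^{k-1}(U)\ \text{for all } f\in\mathcal{O}_M(U)\},$$ where all $\mathbb{R}$-linear endomorphisms are allowed, $f$ is identified with the multiplication by $f$, and $[-,-]$ is the graded commutator, the bilinear extension of $[D,E]=DE-(-1)^{\langle\deg D,\deg E\rangle}ED$. Theorem. Let $k\in\mathbb{N}$. Every $\mathcal{D}^k(U)$ is a $\mathbb{Z}_2^n$-graded $\mathcal{O}_M(U)$-module. There is exactly one way to make $U\mapsto\mathcal{D}^k(U)$ a presheaf of $\mathbb{Z}_2^n$-graded $\mathcal{O}_M$-modules with restrictions that satisfy $(D|_V)(g|_V)=(Dg)|_V$ for all open $V\subset U$, $D\in\mathcal{D}^k(U)$ and $g\in\mathcal{O}_M(U)$. This presheaf $\mathcal{D}^k_M$ is a sheaf, and it is a locally free sheaf of $\mathbb{Z}_2^n$-graded $\mathcal{O}_M$-modules (of finite rank). More precisely, let $(x,\theta,\zeta)$ be coordinates on an open $U\subset M$, given by an isomorphism of $(U,\mathcal{O}_M|_U)$ with an open subspace of $\mathbb{R}^{p|\mathbf q}$, where $x$, $\theta$, $\zeta$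 are the coordinates of degree zero, of non-zero even degree and of odd degree. Then the operators $$\partial_\zeta^\gamma\,\partial_\theta^\beta\,\partial_x^\alpha,\qquad \alpha^c,\beta^b\in\mathbb{N},\ \gamma^a\in\{0,1\},\ |\alpha|+|\beta|+|\gamma|\le k,$$ where $\partial_x$, $\partial_\theta$, $\partial_\zeta$ are the graded partial derivatives, composed in decreasing order of the coordinates, are homogeneous elements of $\mathcal{D}^k(U)$ of degree $\sum_b\beta^b\deg\theta^b+\sum_a\gamma^a\deg\zeta^a$. For every open $W\subset U$ their restrictions to $W$ are the corresponding operators of the coordinates restricted to $W$, and they form a basis of the left $\mathcal{O}_M(W)$-module $\mathcal{D}^k(W)$. (The coordinates are ordered with $x$ first, then the even degrees in lexicographic order, then the odd degrees in lexicographic order.) -/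

import Mathlib

open CategoryTheory TopologicalSpace Opposite
open scoped Manifold ContDiff

universe u

noncomputable section

namespace Z2n

/-! ### Degrees and signs -/

/-- The grading group `ℤ₂ⁿ`. -/
abbrev Deg (n : ℕ) : Type := Fin n → ZMod 2

/-- The sign `(-1)^⟨γ, δ⟩`, where `⟨-,-⟩` is the standard scalar product of `ℤ₂ⁿ`. -/
def sgn {n : ℕ} (γ δ : Deg n) : ℝ := (-1) ^ (∑ i, γ i * δ i).val

/-- The total parity of a degree. -/
def parity {n : ℕ} (γ : Deg n) : ZMod 2 := ∑ i, γ i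

/-- A degree is odd if its components sum up to `1`. -/
def IsOdd {n : ℕ} (γ : Deg n) : Prop := parity γ = 1

theorem sgn_add_left {n : ℕ} (γ γ' δ : Deg n) : sgn (γ + γ') δ = sgn γ δ * sgn γ' δ := by
  have key : ∀ a b : ZMod 2, ((-1 : ℝ)) ^ (a + b).val = (-1) ^ a.val * (-1) ^ b.val := by
    intro a b
    rw [← pow_add, ZMod.val_add, ← neg_one_pow_eq_pow_mod_two]
  simp only [sgn, Pi.add_apply, add_mul, Finset.sum_add_distrib, key]

theorem sgn_comm {n : ℕ} (γ δ : Deg n) : sgn γ δ = sgn δ γ := by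
  simp only [sgn, mul_comm]

theorem sgn_add_right {n : ℕ} (γ δ δ' : Deg n) : sgn γ (δ + δ') = sgn γ δ * sgn γ δ' := by
  rw [sgn_comm, sgn_add_left, sgn_comm δ, sgn_comm δ']

/-! ### Formal power series in `ℤ₂ⁿ`-commuting variables -/

section Series

variable {n : ℕ} {ι : Type} [Fintype ι] [LinearOrder ι]

/-- Exponents of monomials: an odd variable squares to zero, so its exponent is `0` or `1`. -/
def Admissible (d : ι → Deg n) (α : ι →₀ ℕ) : Prop := ∀ a, IsOdd (d a) → α a ≤ 1

/-- Multi-indices: arbitrary exponents for the even variables, exponents in `{0, 1}` for the odd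
ones. -/
abbrev MultiIdx (d : ι → Deg n) : Type := {α : ι →₀ ℕ // Admissible d α}

/-- The degree `∑ α_a deg ξ_a` of the monomial `ξ^α`. -/
def monDeg (d : ι → Deg n) (α : ι →₀ ℕ) : Deg n := ∑ a, α a • d a

/-- The sign in `ξ^α ξ^β = ± ξ^(α+β)`, where `ξ^α` is the product of the `ξ_a^(α_a)` in increasing
order of `a`. -/
def cocycle (d : ι → Deg n) (α β : ι →₀ ℕ) : ℝ :=
  ∏ a, ∏ b, if b < a then sgn (d a) (d b) ^ (α a * β b) else 1

/-- Formal power series `∑_α f_α ξ^α` in `ℤ₂ⁿ`-commuting variables `ξ_a` of degrees `d a`, with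
coefficients `f_α` in a commutative algebra `R` of degree zero. -/
def Series (d : ι → Deg n) (R : Type) : Type := MultiIdx d → R

namespace Series

variable {d : ι → Deg n} {R : Type} [CommRing R] [Algebra ℝ R]

instance : AddCommGroup (Series d R) := inferInstanceAs (AddCommGroup (MultiIdx d → R))

instance : Module ℝ (Series d R) := inferInstanceAs (Module ℝ (MultiIdx d → R))

open Classical in
/-- The coefficient of `ξ^α`, which is zero if `α` is not an admissible exponent. -/
def coeff (α : ι →₀ ℕ) (f : Series d R) : R := if h : Admissible d α then f ⟨α, h⟩ else 0

/-- The product determined by `ξ^α ξ^β = ± ξ^(α+β)`. -/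
instance : Mul (Series d R) where
  mul f g := fun γ => ∑ p ∈ Finset.HasAntidiagonal.antidiagonal γ.1,
    cocycle d p.1 p.2 • (coeff p.1 f * coeff p.2 g)

instance : One (Series d R) where
  one := fun γ => if γ.1 = 0 then 1 else 0

@[ext]
theorem ext {f g : Series d R} (h : ∀ α, Admissible d α → coeff α f = coeff α g) : f = g := by
  funext α
  have := h α.1 α.2
  simpa [coeff, α.2] using this

theorem coeff_add (α : ι →₀ ℕ) (f g : Series d R) : coeff α (f + g) = coeff α f + coeff α g := by
  by_cases h : Admissible d α
  · simp only [coeff, h, dite_true]; rfl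
  · simp [coeff, h]

theorem coeff_smul (α : ι →₀ ℕ) (r : ℝ) (f : Series d R) : coeff α (r • f) = r • coeff α f := by
  by_cases h : Admissible d α
  · simp only [coeff, h, dite_true]; rfl
  · simp [coeff, h]

theorem coeff_zero (α : ι →₀ ℕ) : coeff α (0 : Series d R) = 0 := by
  by_cases h : Admissible d α
  · simp only [coeff, h, dite_true]; rfl
  · simp [coeff, h]

theorem coeff_mul {α : ι →₀ ℕ} (h : Admissible d α) (f g : Series d R) :
    coeff α (f * g) = ∑ p ∈ Finset.HasAntidiagonal.antidiagonal α,
      cocycle d p.1 p.2 • (coeff p.1 f * coeff p.2 g) := by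
  simp only [coeff, h, dite_true]; rfl

theorem coeff_one (α : ι →₀ ℕ) : coeff α (1 : Series d R) = if α = 0 then 1 else 0 := by
  by_cases h : Admissible d α
  · simp only [coeff, h, dite_true]; rfl
  · have : α ≠ 0 := by rintro rfl; exact h (fun a _ => by simp)
    simp [coeff, h, this]

theorem cocycle_zero_left (β : ι →₀ ℕ) : cocycle d 0 β = 1 := by simp [cocycle]

theorem cocycle_zero_right (α : ι →₀ ℕ) : cocycle d α 0 = 1 := by simp [cocycle]

theorem cocycle_add_left (α α' β : ι →₀ ℕ) :
    cocycle d (α + α') β = cocycle d α β * cocycle d α' β := by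
  simp only [cocycle, ← Finset.prod_mul_distrib]
  refine Finset.prod_congr rfl fun a _ => Finset.prod_congr rfl fun b _ => ?_
  split_ifs
  · rw [Finsupp.add_apply, add_mul, pow_add]
  · simp

theorem cocycle_add_right (α β β' : ι →₀ ℕ) :
    cocycle d α (β + β') = cocycle d α β * cocycle d α β' := by
  simp only [cocycle, ← Finset.prod_mul_distrib]
  refine Finset.prod_congr rfl fun a _ => Finset.prod_congr rfl fun b _ => ?_
  split_ifs
  · rw [Finsupp.add_apply, mul_add, pow_add]
  · simp

theorem Admissible.of_add_left {α β : ι →₀ ℕ} (h : Admissible d (α + β)) : Admissible d α :=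
  fun a ha => le_trans (by simp) (h a ha)

theorem Admissible.of_add_right {α β : ι →₀ ℕ} (h : Admissible d (α + β)) : Admissible d β :=
  fun a ha => le_trans (by simp) (h a ha)

protected theorem one_mul (f : Series d R) : 1 * f = f := by
  ext α h
  rw [coeff_mul h, Finset.sum_eq_single (0, α)]
  · simp [coeff_one, cocycle_zero_left]
  · rintro ⟨a, b⟩ hab hne
    have : a ≠ 0 := by
      rintro rfl
      simp only [Finset.HasAntidiagonal.mem_antidiagonal, zero_add] at hab
      exact hne (by rw [hab])
    simp [coeff_one, this]
  · simp

protected theorem mul_one (f : Series d R) : f * 1 = f := by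
  ext α h
  rw [coeff_mul h, Finset.sum_eq_single (α, 0)]
  · simp [coeff_one, cocycle_zero_right]
  · rintro ⟨a, b⟩ hab hne
    have : b ≠ 0 := by
      rintro rfl
      simp only [Finset.HasAntidiagonal.mem_antidiagonal, add_zero] at hab
      exact hne (by rw [hab])
    simp [coeff_one, this]
  · simp

protected theorem mul_assoc (f g k : Series d R) : f * g * k = f * (g * k) := by
  ext α h
  rw [coeff_mul h, coeff_mul h]
  have e1 : ∀ p ∈ Finset.HasAntidiagonal.antidiagonal α,
      cocycle d p.1 p.2 • (coeff p.1 (f * g) * coeff p.2 k) =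
      ∑ s ∈ Finset.HasAntidiagonal.antidiagonal p.1, (cocycle d s.1 s.2 * cocycle d s.1 p.2 * cocycle d s.2 p.2) •
        (coeff s.1 f * coeff s.2 g * coeff p.2 k) := by
    intro p hp
    rw [Finset.HasAntidiagonal.mem_antidiagonal] at hp
    subst hp
    rw [coeff_mul (Admissible.of_add_left h), Finset.sum_mul, Finset.smul_sum]
    refine Finset.sum_congr rfl fun s hs => ?_
    rw [Finset.HasAntidiagonal.mem_antidiagonal] at hs
    rw [← hs, cocycle_add_left, smul_mul_assoc, smul_smul]
    congr 1
    ring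
  have e2 : ∀ p ∈ Finset.HasAntidiagonal.antidiagonal α,
      cocycle d p.1 p.2 • (coeff p.1 f * coeff p.2 (g * k)) =
      ∑ s ∈ Finset.HasAntidiagonal.antidiagonal p.2, (cocycle d p.1 s.1 * cocycle d p.1 s.2 * cocycle d s.1 s.2) •
        (coeff p.1 f * coeff s.1 g * coeff s.2 k) := by
    intro p hp
    rw [Finset.HasAntidiagonal.mem_antidiagonal] at hp
    subst hp
    rw [coeff_mul (Admissible.of_add_right h), Finset.mul_sum, Finset.smul_sum]
    refine Finset.sum_congr rfl fun s hs => ?_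
    rw [Finset.HasAntidiagonal.mem_antidiagonal] at hs
    rw [← hs, cocycle_add_right, mul_smul_comm, smul_smul, mul_assoc (coeff p.1 f)]
  rw [Finset.sum_congr rfl e1, Finset.sum_congr rfl e2]
  simp only [Finset.sum_sigma']
  refine Finset.sum_nbij' (fun x => ⟨(x.2.1, x.2.2 + x.1.2), (x.2.2, x.1.2)⟩)
    (fun x => ⟨(x.1.1 + x.2.1, x.2.2), (x.1.1, x.2.1)⟩) ?_ ?_ ?_ ?_ ?_
  · rintro ⟨⟨a, b⟩, ⟨s, t⟩⟩ hx
    simp only [Finset.mem_sigma, Finset.HasAntidiagonal.mem_antidiagonal] at hx ⊢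
    obtain ⟨rfl, rfl⟩ := hx
    exact ⟨by rw [add_assoc], trivial⟩
  · rintro ⟨⟨a, b⟩, ⟨s, t⟩⟩ hx
    simp only [Finset.mem_sigma, Finset.HasAntidiagonal.mem_antidiagonal] at hx ⊢
    obtain ⟨rfl, rfl⟩ := hx
    exact ⟨by rw [add_assoc], trivial⟩
  · rintro ⟨⟨a, b⟩, ⟨s, t⟩⟩ hx
    simp only [Finset.mem_sigma, Finset.HasAntidiagonal.mem_antidiagonal] at hx
    obtain ⟨rfl, rfl⟩ := hx
    rfl
  · rintro ⟨⟨a, b⟩, ⟨s, t⟩⟩ hx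
    simp only [Finset.mem_sigma, Finset.HasAntidiagonal.mem_antidiagonal] at hx
    obtain ⟨rfl, rfl⟩ := hx
    rfl
  · rintro ⟨⟨a, b⟩, ⟨s, t⟩⟩ hx
    rfl

instance : Ring (Series d R) where
  __ := (inferInstance : AddCommGroup (Series d R))
  zero_mul f := by
    ext α h
    simp [coeff_mul h, coeff_zero]
  mul_zero f := by
    ext α h
    simp [coeff_mul h, coeff_zero]
  left_distrib f g k := by
    ext α h
    simp only [coeff_mul h, coeff_add, mul_add, smul_add, Finset.sum_add_distrib]
  right_distrib f g k := by
    ext α h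
    simp only [coeff_mul h, coeff_add, add_mul, smul_add, Finset.sum_add_distrib]
  one_mul := Series.one_mul
  mul_one := Series.mul_one
  mul_assoc := Series.mul_assoc

instance : Algebra ℝ (Series d R) :=
  Algebra.ofModule
    (fun r f g => by
      ext α h
      simp only [coeff_mul h, coeff_smul, smul_mul_assoc, Finset.smul_sum, smul_comm r])
    (fun r f g => by
      ext α h
      simp only [coeff_mul h, coeff_smul, mul_smul_comm, Finset.smul_sum, smul_comm r])

/-- The homogeneous part of degree `γ`: the series in the monomials of degree `γ`. -/
def homogeneous (γ : Deg n) : Submodule ℝ (Series d R) where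
  carrier := {f | ∀ α, monDeg d α ≠ γ → coeff α f = 0}
  add_mem' hf hg α hα := by rw [coeff_add, hf α hα, hg α hα, add_zero]
  zero_mem' α _ := coeff_zero α
  smul_mem' r f hf α hα := by rw [coeff_smul, hf α hα, smul_zero]

/-- Apply a linear map to all coefficients. -/
def mapCoeff {S : Type} [CommRing S] [Algebra ℝ S] (φ : R →ₗ[ℝ] S) :
    Series d R →ₗ[ℝ] Series d S where
  toFun f := fun α => φ (f α)
  map_add' f g := funext fun α => map_add φ (f α) (g α)
  map_smul' r f := funext fun α => map_smul φ r (f α)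

/-- The graded (left) partial derivative with respect to the variable `ξ_a`: on monomials,
`∂_a ξ^μ = (∏_{b < a} (-1)^(⟨deg ξ_a, deg ξ_b⟩ μ_b)) μ_a ξ^(μ - e_a)`. -/
def formalDeriv (a : ι) : Series d R →ₗ[ℝ] Series d R where
  toFun f := fun α => ((∏ b, if b < a then sgn (d a) (d b) ^ α.1 b else 1) * (α.1 a + 1 : ℝ)) •
    coeff (α.1 + Finsupp.single a 1) f
  map_add' f g := funext fun α => by
    rw [coeff_add, smul_add]; rfl
  map_smul' r f := funext fun α => by
    rw [coeff_smul, smul_comm]; rfl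

end Series

end Series

/-! ### The domain `ℝ^{p|q}` -/

/-- The formal coordinates of a domain with `q γ` coordinates of each non-zero degree `γ`. -/
def FormalVar {n : ℕ} (q : {γ : Deg n // γ ≠ 0} → ℕ) : Type := Σ γ, Fin (q γ)

namespace FormalVar

variable {n : ℕ} {q : {γ : Deg n // γ ≠ 0} → ℕ}

instance : Fintype (FormalVar q) := by
  classical exact inferInstanceAs (Fintype (Σ γ, Fin (q γ)))

/-- The degree of a formal coordinate. -/
def deg (a : FormalVar q) : Deg n := a.1.1

/-- The key for the standard order of coordinates: first the even degrees in lexicographic order,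
then the odd degrees in lexicographic order; coordinates of the same degree are ordered by their
number. -/
def key (a : FormalVar q) : ℕ ×ₗ (Lex (Fin n → ℕ)) ×ₗ ℕ :=
  toLex ((parity a.deg).val, toLex (toLex (fun i => (a.deg i).val), a.2.val))

theorem key_injective : Function.Injective (key (q := q)) := by
  rintro ⟨⟨γ, hγ⟩, i⟩ ⟨⟨δ, hδ⟩, j⟩ h
  simp only [key, deg, EmbeddingLike.apply_eq_iff_eq, Prod.mk.injEq] at h
  obtain ⟨-, h1, h2⟩ := h
  have : γ = δ := funext fun k => ZMod.val_injective 2 (congrFun h1 k)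
  subst this
  have : i = j := Fin.ext h2
  subst this
  rfl

instance : LinearOrder (FormalVar q) := LinearOrder.lift' key key_injective

end FormalVar

/-- The degree zero coordinate space. -/
abbrev Base (p : ℕ) : Type := EuclideanSpace ℝ (Fin p)

/-- Smooth functions on an open subset of `ℝ^p`. -/
abbrev Smooth {p : ℕ} (V : Opens (Base p)) : Type := C^∞⟮𝓘(ℝ, Base p), V; 𝓘(ℝ, ℝ), ℝ⟯

/-- The sections `C^∞(V)[[ξ]]` of the structure sheaf of `ℝ^{p|q}` over `V`. -/
abbrev DomainSections {n p : ℕ} (q : {γ : Deg n // γ ≠ 0} → ℕ) (V : Opens (Base p)) : Type :=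
  Series (FormalVar.deg (q := q)) (Smooth V)

/-- The restriction of smooth functions. -/
def smoothRes {p : ℕ} {V W : Opens (Base p)} (h : W ≤ V) : Smooth V →ₗ[ℝ] Smooth W where
  toFun f := ContMDiffMap.restrictRingHom 𝓘(ℝ, Base p) 𝓘(ℝ, ℝ) ℝ h f
  map_add' f g := map_add _ f g
  map_smul' _ _ := rfl

/-- The restriction in the structure sheaf of `ℝ^{p|q}`. -/
def domainRes {n p : ℕ} (q : {γ : Deg n // γ ≠ 0} → ℕ) {V W : Opens (Base p)} (h : W ≤ V) :
    DomainSections q V →ₗ[ℝ] DomainSections q W :=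
  Series.mapCoeff (smoothRes h)

open Classical in
/-- Extension by zero of a function on an open subset. -/
def extendZero {p : ℕ} {V : Opens (Base p)} (f : V → ℝ) (x : Base p) : ℝ :=
  if h : x ∈ V then f ⟨x, h⟩ else 0

theorem extendZero_coe {p : ℕ} {V : Opens (Base p)} (f : V → ℝ) (x : V) :
    extendZero f x = f x := by
  simp [extendZero]

theorem contDiffAt_extendZero {p : ℕ} {V : Opens (Base p)} (f : Smooth V) (x : V) :
    ContDiffAt ℝ ∞ (extendZero f) (x : Base p) := by
  have h : ContMDiffAt 𝓘(ℝ, Base p) 𝓘(ℝ, ℝ) ∞ (fun y : V => extendZero f (y : Base p)) x := by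
    have : (fun y : V => extendZero f (y : Base p)) = f := funext fun y => extendZero_coe f y
    rw [this]
    exact f.contMDiff x
  exact (contMDiffAt_subtype_iff.mp h).contDiffAt

/-- The partial derivative `∂/∂x^i` of smooth functions on an open subset of `ℝ^p`. -/
def smoothDeriv {p : ℕ} {V : Opens (Base p)} (i : Fin p) : Smooth V →ₗ[ℝ] Smooth V where
  toFun f := ⟨fun x => fderiv ℝ (extendZero f) (x : Base p) (EuclideanSpace.single i 1), by
    intro x
    have h := ((contDiffAt_extendZero f x).fderiv_right (m := ∞) (by simp)).clm_apply
      (contDiffAt_const (c := (EuclideanSpace.single i 1 : Base p)))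
    exact contMDiffAt_subtype_iff.mpr h.contMDiffAt⟩
  map_add' f g := by
    ext x
    have e : extendZero (⇑(f + g)) = extendZero f + extendZero g := by
      funext y
      by_cases hy : y ∈ V <;> simp [extendZero, hy]
    change fderiv ℝ (extendZero (⇑(f + g))) (x : Base p) _ = fderiv ℝ (extendZero f) (x : Base p) _ +
      fderiv ℝ (extendZero g) (x : Base p) _
    rw [e, fderiv_add ((contDiffAt_extendZero f x).differentiableAt (by simp))
      ((contDiffAt_extendZero g x).differentiableAt (by simp))]
    rfl
  map_smul' r f := by
    ext x
    have e : extendZero (⇑(r • f)) = r • extendZero f := by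
      funext y
      by_cases hy : y ∈ V <;> simp [extendZero, hy]
    change fderiv ℝ (extendZero (⇑(r • f))) (x : Base p) _ =
      r • fderiv ℝ (extendZero f) (x : Base p) _
    rw [e, fderiv_const_smul ((contDiffAt_extendZero f x).differentiableAt (by simp))]
    rfl

/-- The exponents `(α, (β, γ))` with `|α| + |β| + |γ| ≤ k`, where `α` are the exponents for the
coordinates `x` of degree zero, `β` the exponents for the coordinates `θ` of non-zero even degree
and `γ` the exponents, all `0` or `1`, for the odd coordinates `ζ`; the pair `(β, γ)` is a
multi-index for the formal coordinates. -/
def DerivIdx {n : ℕ} (p : ℕ) (q : {γ : Deg n // γ ≠ 0} → ℕ) (k : ℕ) : Type :=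
  {i : (Fin p → ℕ) × MultiIdx (FormalVar.deg (q := q)) // ∑ c, i.1 c + ∑ a, i.2.1 a ≤ k}

/-- The degree of `∂_ζ^γ ∂_θ^β ∂_x^α`. -/
def DerivIdx.deg {n p k : ℕ} {q : {γ : Deg n // γ ≠ 0} → ℕ} (i : DerivIdx p q k) : Deg n :=
  monDeg FormalVar.deg i.1.2.1

/-- The operator `∂_ζ^γ ∂_θ^β ∂_x^α` on `C^∞(V)[[ξ]]`: the composition of the powers of the partial
derivatives in decreasing order of the coordinates (recall that in the increasing order the
coordinates of degree zero come first, followed by the even and finally by the odd ones). -/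
def domainDeriv {n p k : ℕ} {q : {γ : Deg n // γ ≠ 0} → ℕ} (V : Opens (Base p))
    (i : DerivIdx p q k) : Module.End ℝ (DomainSections q V) :=
  (((Finset.univ : Finset (FormalVar q)).sort (· ≥ ·)).map
      (fun a => (Series.formalDeriv a : Module.End ℝ (DomainSections q V)) ^ i.1.2.1 a)).prod *
    ((List.finRange p).reverse.map
      (fun c => (Series.mapCoeff (smoothDeriv c) : Module.End ℝ (DomainSections q V)) ^
        i.1.1 c)).prod

/-! ### Algebraic differential operators of a graded algebra -/

section DiffOp

variable {n : ℕ} {A : Type*} [Ring A] [Algebra ℝ A] (𝒜 : Deg n → Submodule ℝ A)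

/-- The `ℝ`-linear maps of degree `γ`. -/
def endHomogeneous (γ : Deg n) : Submodule ℝ (Module.End ℝ A) where
  carrier := {D | ∀ δ, ∀ a ∈ 𝒜 δ, D a ∈ 𝒜 (δ + γ)}
  add_mem' hD hE δ a ha := (𝒜 _).add_mem (hD δ a ha) (hE δ a ha)
  zero_mem' _ _ _ := (𝒜 _).zero_mem
  smul_mem' r _ hD δ a ha := (𝒜 _).smul_mem r (hD δ a ha)

variable [GradedAlgebra 𝒜]

/-- The component of degree `γ` of an `ℝ`-linear map. -/
def endComponent (γ : Deg n) (D : Module.End ℝ A) : Module.End ℝ A :=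
  ∑ δ, GradedAlgebra.proj 𝒜 (δ + γ) ∘ₗ D ∘ₗ GradedAlgebra.proj 𝒜 δ

/-- The graded commutator: the bilinear extension of `[D, E] = D E - (-1)^⟨deg D, deg E⟩ E D`. -/
def gradedCommutator (D E : Module.End ℝ A) : Module.End ℝ A :=
  ∑ γ, ∑ δ, (endComponent 𝒜 γ D * endComponent 𝒜 δ E -
    sgn γ δ • (endComponent 𝒜 δ E * endComponent 𝒜 γ D))

/-- Differential operators of order `k`, defined by induction: the graded commutator with the
multiplication by any element has order `k - 1`, the only operator of order `-1` being `0`. -/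
def IsDiffOp : ℕ → Module.End ℝ A → Prop
  | 0, D => ∀ f : A, gradedCommutator 𝒜 D (LinearMap.mulLeft ℝ f) = 0
  | k + 1, D => ∀ f : A, IsDiffOp k (gradedCommutator 𝒜 D (LinearMap.mulLeft ℝ f))

theorem endComponent_add (γ : Deg n) (D E : Module.End ℝ A) :
    endComponent 𝒜 γ (D + E) = endComponent 𝒜 γ D + endComponent 𝒜 γ E := by
  simp only [endComponent, LinearMap.add_comp, LinearMap.comp_add, Finset.sum_add_distrib]

theorem endComponent_apply (γ : Deg n) (D : Module.End ℝ A) (a : A) :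
    endComponent 𝒜 γ D a =
      ∑ δ, GradedAlgebra.proj 𝒜 (δ + γ) (D (GradedAlgebra.proj 𝒜 δ a)) := by
  simp [endComponent, LinearMap.sum_apply]

theorem gradedCommutator_add_left (D D' E : Module.End ℝ A) :
    gradedCommutator 𝒜 (D + D') E = gradedCommutator 𝒜 D E + gradedCommutator 𝒜 D' E := by
  simp only [gradedCommutator, endComponent_add, ← Finset.sum_add_distrib]
  refine Finset.sum_congr rfl fun γ _ => Finset.sum_congr rfl fun δ _ => ?_
  rw [add_mul, mul_add, smul_add]
  abel

theorem gradedCommutator_add_right (D E E' : Module.End ℝ A) :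
    gradedCommutator 𝒜 D (E + E') = gradedCommutator 𝒜 D E + gradedCommutator 𝒜 D E' := by
  simp only [gradedCommutator, endComponent_add, ← Finset.sum_add_distrib]
  refine Finset.sum_congr rfl fun γ _ => Finset.sum_congr rfl fun δ _ => ?_
  rw [add_mul, mul_add, smul_add]
  abel

theorem gradedCommutator_zero_left (E : Module.End ℝ A) : gradedCommutator 𝒜 0 E = 0 := by
  simpa using gradedCommutator_add_left 𝒜 0 0 E

theorem gradedCommutator_zero_right (D : Module.End ℝ A) : gradedCommutator 𝒜 D 0 = 0 := by
  simpa using gradedCommutator_add_right 𝒜 D 0 0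

theorem proj_mul_of_mem {φ : Deg n} {f : A} (hf : f ∈ 𝒜 φ) (γ : Deg n) (a : A) :
    GradedAlgebra.proj 𝒜 (φ + γ) (f * a) = f * GradedAlgebra.proj 𝒜 γ a := by
  simp only [GradedAlgebra.proj_apply]
  exact DirectSum.coe_decompose_mul_add_of_left_mem 𝒜 hf

/-- Multiplication by a homogeneous element shifts the degree. -/
theorem endComponent_smul {φ : Deg n} {f : A} (hf : f ∈ 𝒜 φ) (γ : Deg n) (D : Module.End ℝ A) :
    endComponent 𝒜 (φ + γ) (f • D) = f • endComponent 𝒜 γ D := by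
  ext a
  simp only [endComponent_apply, LinearMap.smul_apply, smul_eq_mul, Finset.mul_sum]
  refine Finset.sum_congr rfl fun δ _ => ?_
  rw [← proj_mul_of_mem 𝒜 hf, add_left_comm]

theorem sum_proj (a : A) : ∑ δ, GradedAlgebra.proj 𝒜 δ a = a := by
  classical
  simp only [GradedAlgebra.proj_apply]
  conv_rhs => rw [← DirectSum.sum_support_decompose 𝒜 a]
  symm
  apply Finset.sum_subset (Finset.subset_univ _)
  intro x _ hx
  simpa using hx

theorem sum_endComponent (D : Module.End ℝ A) : ∑ γ, endComponent 𝒜 γ D = D := by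
  ext a
  simp only [LinearMap.sum_apply, endComponent_apply]
  rw [Finset.sum_comm]
  have : ∀ δ, ∑ γ, GradedAlgebra.proj 𝒜 (δ + γ) (D (GradedAlgebra.proj 𝒜 δ a)) =
      D (GradedAlgebra.proj 𝒜 δ a) := by
    intro δ
    conv_rhs => rw [← sum_proj 𝒜 (D (GradedAlgebra.proj 𝒜 δ a))]
    exact Equiv.sum_comp (Equiv.addLeft δ)
      (fun x => GradedAlgebra.proj 𝒜 x (D (GradedAlgebra.proj 𝒜 δ a)))
  simp only [this, ← map_sum, sum_proj]

theorem endComponent_mulLeft {ψ : Deg n} {g : A} (hg : g ∈ 𝒜 ψ) (γ : Deg n) :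
    endComponent 𝒜 γ (LinearMap.mulLeft ℝ g) = if γ = ψ then LinearMap.mulLeft ℝ g else 0 := by
  ext a
  simp only [endComponent_apply, LinearMap.mulLeft_apply]
  have key : ∀ δ, GradedAlgebra.proj 𝒜 (δ + γ) (g * GradedAlgebra.proj 𝒜 δ a) =
      if γ = ψ then g * GradedAlgebra.proj 𝒜 δ a else 0 := by
    intro δ
    have hmem : g * GradedAlgebra.proj 𝒜 δ a ∈ 𝒜 (δ + ψ) := by
      rw [add_comm]
      exact SetLike.mul_mem_graded hg (by rw [GradedAlgebra.proj_apply]; exact SetLike.coe_mem _)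
    split_ifs with h
    · subst h
      rw [GradedAlgebra.proj_apply]
      exact DirectSum.decompose_of_mem_same 𝒜 hmem
    · rw [GradedAlgebra.proj_apply]
      exact DirectSum.decompose_of_mem_ne 𝒜 hmem (fun e => h (add_left_cancel e).symm)
  simp only [key]
  split_ifs
  · rw [← Finset.mul_sum, sum_proj, LinearMap.mulLeft_apply]
  · simp

theorem gradedCommutator_mulLeft {ψ : Deg n} {g : A} (hg : g ∈ 𝒜 ψ) (D : Module.End ℝ A) :
    gradedCommutator 𝒜 D (LinearMap.mulLeft ℝ g) =
      ∑ γ, (endComponent 𝒜 γ D * LinearMap.mulLeft ℝ g -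
        sgn γ ψ • (LinearMap.mulLeft ℝ g * endComponent 𝒜 γ D)) := by
  refine Finset.sum_congr rfl fun γ _ => ?_
  rw [Finset.sum_eq_single ψ]
  · simp [endComponent_mulLeft 𝒜 hg]
  · intro δ _ hδ
    simp [endComponent_mulLeft 𝒜 hg, hδ]
  · simp

/-- The `ℤ₂ⁿ`-commutation rule `a b = (-1)^⟨deg a, deg b⟩ b a`. -/
def GradedCommutative (𝒜 : Deg n → Submodule ℝ A) : Prop :=
  ∀ γ δ, ∀ a ∈ 𝒜 γ, ∀ b ∈ 𝒜 δ, a * b = sgn γ δ • (b * a)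

theorem sgn_mul_self (γ δ : Deg n) : sgn γ δ * sgn γ δ = 1 := by
  rw [sgn, ← mul_pow]; simp

variable {𝒜}

theorem gradedCommutator_smul (h𝒜 : GradedCommutative 𝒜) (f g : A) (D : Module.End ℝ A) :
    gradedCommutator 𝒜 (f • D) (LinearMap.mulLeft ℝ g) =
      f • gradedCommutator 𝒜 D (LinearMap.mulLeft ℝ g) := by
  have hom : ∀ φ ψ, ∀ f ∈ 𝒜 φ, ∀ g ∈ 𝒜 ψ,
      gradedCommutator 𝒜 (f • D) (LinearMap.mulLeft ℝ g) =
        f • gradedCommutator 𝒜 D (LinearMap.mulLeft ℝ g) := by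
    intro φ ψ f hf g hg
    rw [gradedCommutator_mulLeft 𝒜 hg, gradedCommutator_mulLeft 𝒜 hg, Finset.smul_sum,
      ← Equiv.sum_comp (Equiv.addLeft φ)]
    refine Finset.sum_congr rfl fun γ _ => ?_
    rw [Equiv.coe_addLeft, endComponent_smul 𝒜 hf]
    ext a
    simp only [LinearMap.sub_apply, LinearMap.smul_apply, Module.End.mul_apply,
      LinearMap.mulLeft_apply, smul_eq_mul, mul_sub]
    rw [← mul_assoc g f, h𝒜 ψ φ g hg f hf, smul_mul_assoc, smul_smul, sgn_add_left,
      sgn_comm ψ φ, mul_right_comm, sgn_mul_self, one_mul, mul_assoc, mul_smul_comm]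
  have hg : ∀ φ, ∀ f ∈ 𝒜 φ, ∀ g, gradedCommutator 𝒜 (f • D) (LinearMap.mulLeft ℝ g) =
        f • gradedCommutator 𝒜 D (LinearMap.mulLeft ℝ g) := by
    intro φ f hf g
    induction g using DirectSum.Decomposition.inductionOn 𝒜 with
    | zero => simp [gradedCommutator_zero_right]
    | homogeneous g => exact hom _ _ f hf _ g.2
    | add a b ha hb =>
      have e : LinearMap.mulLeft ℝ (a + b) = LinearMap.mulLeft ℝ a + LinearMap.mulLeft ℝ b := by
        ext; simp [add_mul]
      rw [e, gradedCommutator_add_right, gradedCommutator_add_right, ha, hb, smul_add]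
  induction f using DirectSum.Decomposition.inductionOn 𝒜 with
  | zero => simp [gradedCommutator_zero_left]
  | homogeneous f => exact hg _ _ f.2 g
  | add a b ha hb => rw [add_smul, gradedCommutator_add_left, ha, hb, add_smul]

/-- The `A`-module of differential operators of order `k`, a submodule of the `A`-module of all
`ℝ`-linear maps from `A` to itself (those are the sums of `ℝ`-linear maps of all degrees). -/
def diffOp (h𝒜 : GradedCommutative 𝒜) (k : ℕ) : Submodule A (Module.End ℝ A) where
  carrier := {D | IsDiffOp 𝒜 k D}
  add_mem' := by
    suffices h : ∀ D E, IsDiffOp 𝒜 k D → IsDiffOp 𝒜 k E → IsDiffOp 𝒜 k (D + E) from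
      fun {D E} hD hE => h D E hD hE
    induction k with
    | zero => intro D E hD hE f; rw [gradedCommutator_add_left, hD f, hE f, add_zero]
    | succ k ih =>
      intro D E hD hE f
      rw [gradedCommutator_add_left]
      exact ih _ _ (hD f) (hE f)
  zero_mem' := by
    change IsDiffOp 𝒜 k 0
    induction k with
    | zero => intro f; exact gradedCommutator_zero_left 𝒜 _
    | succ k ih => intro f; rw [gradedCommutator_zero_left]; exact ih
  smul_mem' := by
    change ∀ (c : A) (D : Module.End ℝ A), IsDiffOp 𝒜 k D → IsDiffOp 𝒜 k (c • D)
    induction k with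
    | zero => intro c D hD f; rw [gradedCommutator_smul h𝒜, hD f, smul_zero]
    | succ k ih =>
      intro c D hD f
      rw [gradedCommutator_smul h𝒜]
      exact ih c _ (hD f)

end DiffOp

/-! ### `ℤ₂ⁿ`-manifolds -/

/-- A topological space with a sheaf of `ℤ₂ⁿ`-graded `ℤ₂ⁿ`-commutative associative unital
`ℝ`-algebras. -/
structure RingedSpace (n : ℕ) extends
    AlgebraicGeometry.SheafedSpace.{u + 1, u, u} (AlgCat.{u} ℝ) where
  /-- The homogeneous parts of the algebra of sections over `U`. -/
  part : ∀ U : Opens carrier, Deg n → Submodule ℝ (presheaf.obj (op U))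
  [graded : ∀ U, GradedAlgebra (part U)]
  map_mem_part : ∀ {U V : Opens carrier} (h : V ≤ U) (γ : Deg n), ∀ f ∈ part U γ,
    (presheaf.map (homOfLE h).op).hom f ∈ part V γ
  graded_comm : ∀ U, GradedCommutative (part U)

attribute [instance] RingedSpace.graded

/-- A ring with a set of homogeneous elements is graded local if it has a unique maximal
homogeneous ideal, that is, a unique ideal which is maximal among the proper ideals that are
generated by homogeneous elements. -/
def IsGradedLocal {R : Type*} [Ring R] (hom : Set R) : Prop :=
  ∃! I : Ideal R, Maximal (fun J : Ideal R => J ≠ ⊤ ∧ Ideal.span {a | a ∈ J ∧ a ∈ hom} = J) I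

/-- The image of an open subset of the source of a partial homeomorphism. -/
def imageOpens {X Y : Type*} [TopologicalSpace X] [TopologicalSpace Y]
    (φ : OpenPartialHomeomorph X Y) (W : Opens X) (hW : (W : Set X) ⊆ φ.source) : Opens Y :=
  ⟨φ '' W, φ.isOpen_image_of_subset_source W.isOpen hW⟩

theorem imageOpens_mono {X Y : Type*} [TopologicalSpace X] [TopologicalSpace Y]
    {φ : OpenPartialHomeomorph X Y} {V W : Opens X} (hW : (W : Set X) ⊆ φ.source) (h : V ≤ W) :
    imageOpens φ V (Set.Subset.trans h hW) ≤ imageOpens φ W hW :=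
  Set.image_mono h

namespace RingedSpace

variable {n : ℕ} (X : RingedSpace.{u} n)

/-- The sections of the structure sheaf. -/
abbrev Sec (U : Opens X.carrier) : Type u := X.presheaf.obj (op U)

/-- The restriction of sections of the structure sheaf. -/
def res {U V : Opens X.carrier} (h : V ≤ U) : X.Sec U →ₐ[ℝ] X.Sec V :=
  (X.presheaf.map (homOfLE h).op).hom

/-- The structure sheaf as a presheaf of rings. -/
def ringPresheaf : TopCat.Presheaf RingCat.{u} X.carrier :=
  X.presheaf ⋙ forget₂ (AlgCat.{u} ℝ) RingCat.{u}

/-- The germs at `x` of homogeneous sections. -/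
def homogeneousGerms (x : X.carrier) : Set (X.ringPresheaf.stalk x) :=
  {s | ∃ (U : Opens X.carrier) (hx : x ∈ U) (γ : Deg n), ∃ f ∈ X.part U γ,
    X.ringPresheaf.germ U x hx f = s}

/-- A coordinate chart: an isomorphism of an open subspace of `X` with an open subspace of the
domain `ℝ^{p|q}`, made of a homeomorphism `φ` and of degree-preserving isomorphisms of algebras of
sections that commute with restrictions. -/
structure Chart (p : ℕ) (q : {γ : Deg n // γ ≠ 0} → ℕ) where
  /-- The homeomorphism on the base. -/
  φ : OpenPartialHomeomorph X.carrier (Base p)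
  /-- The coordinate expression of sections. -/
  equiv : ∀ (W : Opens X.carrier) (hW : (W : Set X.carrier) ⊆ φ.source),
    X.Sec W ≃ₐ[ℝ] DomainSections q (imageOpens φ W hW)
  equiv_mem_homogeneous : ∀ W hW γ f,
    equiv W hW f ∈ Series.homogeneous γ ↔ f ∈ X.part W γ
  equiv_res : ∀ {V W : Opens X.carrier} (hW : (W : Set X.carrier) ⊆ φ.source) (h : V ≤ W) f,
    equiv V (Set.Subset.trans h hW) (X.res h f) =
      domainRes q (imageOpens_mono hW h) (equiv W hW f)

/-- A `ℤ₂ⁿ`-manifold of dimension `p|q`: a locally ringed space that is locally isomorphic to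
`ℝ^{p|q}`, with Hausdorff second-countable underlying topological space. -/
structure IsManifold (p : ℕ) (q : {γ : Deg n // γ ≠ 0} → ℕ) : Prop where
  t2 : T2Space X.carrier
  secondCountable : SecondCountableTopology X.carrier
  local_stalk : ∀ x : X.carrier, IsGradedLocal (X.homogeneousGerms x)
  exists_chart : ∀ x : X.carrier, ∃ c : X.Chart p q, x ∈ c.φ.source

namespace Chart

variable {X} {p k : ℕ} {q : {γ : Deg n // γ ≠ 0} → ℕ} (c : X.Chart p q)

/-- The domain of a chart. -/
def source : Opens X.carrier := ⟨c.φ.source, c.φ.open_source⟩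

/-- The operator `∂_ζ^γ ∂_θ^β ∂_x^α` in the coordinates of a chart, over an open subset `W` of the
chart domain. -/
def deriv (W : Opens X.carrier) (hW : W ≤ c.source) (i : DerivIdx p q k) :
    Module.End ℝ (X.Sec W) :=
  (c.equiv W hW).symm.toLinearMap ∘ₗ domainDeriv _ i ∘ₗ (c.equiv W hW).toLinearMap

end Chart

/-! ### The sheaf of differential operators -/

/-- The module of `k`-th order differential operators over `U`. -/
abbrev diffOp (k : ℕ) (U : Opens X.carrier) : Submodule (X.Sec U) (Module.End ℝ (X.Sec U)) :=
  Z2n.diffOp (X.graded_comm U) k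

/-- The differential operators of order `k` and of degree `γ`. -/
def diffOpPart (k : ℕ) (U : Opens X.carrier) (γ : Deg n) : Submodule ℝ (X.diffOp k U) :=
  (endHomogeneous (X.part U) γ).comap ((X.diffOp k U).subtype.restrictScalars ℝ)

/-- The differential operators of order `k` over `U` form a `ℤ₂ⁿ`-graded module. -/
structure IsGradedDiffOp (k : ℕ) (U : Opens X.carrier) : Prop where
  isInternal : DirectSum.IsInternal (X.diffOpPart k U)
  smul_mem : ∀ γ δ, ∀ f ∈ X.part U γ, ∀ D ∈ X.diffOpPart k U δ, f • D ∈ X.diffOpPart k U (γ + δ)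

/-- The structure of a presheaf of `ℤ₂ⁿ`-graded modules over the structure sheaf on the assignment
`U ↦ D^k(U)`, with restrictions such that `(D|_V)(g|_V) = (D g)|_V`. -/
structure DiffOpPresheaf (k : ℕ) where
  /-- The restriction of differential operators. -/
  res : ∀ {U V : Opens X.carrier}, V ≤ U → X.diffOp k U →+ X.diffOp k V
  res_apply : ∀ {U V : Opens X.carrier} (h : V ≤ U) (D : X.diffOp k U) (g : X.Sec U),
    (res h D).1 (X.res h g) = X.res h (D.1 g)
  res_smul : ∀ {U V : Opens X.carrier} (h : V ≤ U) (f : X.Sec U) (D : X.diffOp k U),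
    res h (f • D) = X.res h f • res h D
  res_mem_part : ∀ {U V : Opens X.carrier} (h : V ≤ U) (γ : Deg n), ∀ D ∈ X.diffOpPart k U γ,
    res h D ∈ X.diffOpPart k V γ
  res_self : ∀ (U : Opens X.carrier) (D : X.diffOp k U), res (le_refl U) D = D
  res_res : ∀ {U V W : Opens X.carrier} (h : V ≤ U) (h' : W ≤ V) (D : X.diffOp k U),
    res h' (res h D) = res (h'.trans h) D

namespace DiffOpPresheaf

variable {X} {k : ℕ} (F : X.DiffOpPresheaf k)

/-- The underlying presheaf of abelian groups. -/
def toPresheaf : TopCat.Presheaf AddCommGrpCat.{u} X.carrier where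
  obj U := AddCommGrpCat.of (X.diffOp k U.unop)
  map f := AddCommGrpCat.ofHom (F.res f.unop.le)
  map_id U := by
    exact AddCommGrpCat.hom_ext (AddMonoidHom.ext fun D => F.res_self U.unop D)
  map_comp f g := by
    exact AddCommGrpCat.hom_ext
      (AddMonoidHom.ext fun D => (F.res_res f.unop.le g.unop.le D).symm)

/-- The homogeneous sections `e i`, of degree `d i`, over `U` are a basis of the graded modules of
differential operators over all open subsets of `U`. -/
def IsLocalBasis (U : Opens X.carrier) {I : Type} (d : I → Deg n) (e : I → X.diffOp k U) : Prop :=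
  (∀ i, e i ∈ X.diffOpPart k U (d i)) ∧
    ∀ (V : Opens X.carrier) (h : V ≤ U),
      ∃ b : Module.Basis I (X.Sec V) (X.diffOp k V), ∀ i, b i = F.res h (e i)

/-- Locally, there is a finite basis of homogeneous sections. -/
def IsLocallyFree : Prop :=
  ∀ x : X.carrier, ∃ U : Opens X.carrier, x ∈ U ∧
    ∃ (I : Type) (_ : Finite I) (d : I → Deg n) (e : I → X.diffOp k U), F.IsLocalBasis U d e

end DiffOpPresheaf

end RingedSpace

end Z2n

end

noncomputable section

namespace Z2n

/-!
A `ℤ₂ⁿ`-manifold has bump functions of degree zero. If `f` vanishes near a point and `σ` is one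
minus a bump function supported there, then `f = σ ^ k f`, and moving the factors `σ` through an
operator `D` of order less than `k` shows that `D f` is a multiple of `σ`. So differential operators
are local; they restrict, in exactly one way, and they glue.

In a chart, an operator of order at most `k` is determined by its values on the monomials of degree
at most `k` in the coordinates. Indeed, if it vanishes on them, then its commutators with the
coordinates have order less than `k` and vanish on the monomials of degree less than `k`, so they
are zero by induction: the operator commutes with the coordinates up to sign and kills `1`, and by
Hadamard's lemma it is zero. The matrix of the values of the coordinate derivatives on these
monomials is triangular for the total degree, with invertible diagonal entries, whence the
derivatives are a basis.
-/

/-! ### Graded commutators and the order of an operator -/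

theorem sgn_zero_left {n : ℕ} (γ : Deg n) : sgn 0 γ = 1 := by simp [sgn]

theorem sgn_zero_right {n : ℕ} (γ : Deg n) : sgn γ 0 = 1 := by simp [sgn]

theorem sgn_self {n : ℕ} (γ : Deg n) : sgn γ γ = (-1) ^ (parity γ).val := by
  have mul_self : ∀ a : ZMod 2, a * a = a := by decide
  simp [sgn, parity, mul_self]

theorem sgn_self_of_isOdd {n : ℕ} {γ : Deg n} (h : IsOdd γ) : sgn γ γ = -1 := by
  rw [sgn_self, show parity γ = 1 from h]
  simp [ZMod.val_one]

theorem sgn_self_of_not_isOdd {n : ℕ} {γ : Deg n} (h : ¬ IsOdd γ) : sgn γ γ = 1 := by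
  have eq_zero_of_ne_one : ∀ a : ZMod 2, a ≠ 1 → a = 0 := by decide
  simp [sgn_self, eq_zero_of_ne_one _ h]

theorem geom_sum_sgn_self_ne_zero {n : ℕ} {γ : Deg n} {m : ℕ} (hm : m ≠ 0) (hγ : IsOdd γ → m ≤ 1) :
    ∑ l ∈ Finset.range m, sgn γ γ ^ l ≠ 0 := by
  by_cases h : IsOdd γ
  · obtain rfl : m = 1 := by have := hγ h; omega
    simp
  · simp [sgn_self_of_not_isOdd h, hm]

theorem sgn_pow_mul_self {n : ℕ} (γ δ : Deg n) (m : ℕ) : sgn γ δ ^ m * sgn γ δ ^ m = 1 := by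
  rw [← mul_pow, sgn_mul_self, one_pow]

section Projections

theorem proj_mem {ι R A : Type*} [DecidableEq ι] [AddMonoid ι] [CommSemiring R] [Semiring A]
    [Algebra R A] (𝒜 : ι → Submodule R A) [GradedAlgebra 𝒜] (i : ι) (a : A) :
    GradedAlgebra.proj 𝒜 i a ∈ 𝒜 i := by
  rw [GradedAlgebra.proj_apply]
  exact SetLike.coe_mem _

theorem proj_of_mem {ι R A : Type*} [DecidableEq ι] [AddMonoid ι] [CommSemiring R] [Semiring A]
    [Algebra R A] (𝒜 : ι → Submodule R A) [GradedAlgebra 𝒜] {i : ι} {a : A} (ha : a ∈ 𝒜 i)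
    (j : ι) : GradedAlgebra.proj 𝒜 j a = if j = i then a else 0 := by
  rw [GradedAlgebra.proj_apply]
  split_ifs with h
  · rw [h, DirectSum.decompose_of_mem_same 𝒜 ha]
  · exact DirectSum.decompose_of_mem_ne 𝒜 ha (Ne.symm h)

theorem isInternal_of_projections {ι R M : Type*} [Fintype ι] [DecidableEq ι] [Semiring R]
    [AddCommMonoid M] [Module R M] (p : ι → Submodule R M) (π : ι → M →ₗ[R] M)
    (hπ : ∀ i m, π i m ∈ p i) (hsum : ∀ m, ∑ i, π i m = m)
    (hp : ∀ i j, ∀ m ∈ p j, π i m = if i = j then m else 0) : DirectSum.IsInternal p := by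
  let decompose : M →ₗ[R] DirectSum ι fun i => p i :=
    ∑ i, DirectSum.lof R ι (fun i => p i) i ∘ₗ (π i).codRestrict (p i) (hπ i)
  have coe_decompose : DirectSum.coeLinearMap p ∘ₗ decompose = LinearMap.id := by
    ext m
    simp [decompose, hsum]
  have decompose_coe : decompose ∘ₗ DirectSum.coeLinearMap p = LinearMap.id := by
    refine DirectSum.linearMap_ext R fun j => LinearMap.ext fun m => ?_
    have proj_eq (i : ι) : (π i).codRestrict (p i) (hπ i) m =
        if h : i = j then h ▸ m else 0 := by
      split_ifs with h
      · subst h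
        exact Subtype.ext (by simp [hp i i m m.2])
      · exact Subtype.ext (by simp [hp i j m m.2, h])
    simp only [decompose, LinearMap.comp_apply, LinearMap.sum_apply, DirectSum.coeLinearMap_lof,
      proj_eq, LinearMap.id_apply]
    rw [Finset.sum_eq_single_of_mem j (Finset.mem_univ j) fun i _ hij => by simp [hij]]
    simp
  exact (DirectSum.Decomposition.ofLinearMap p decompose coe_decompose decompose_coe).isInternal

end Projections

section OrderFiltration

variable {n : ℕ} {A : Type*} [Ring A] [Algebra ℝ A] (𝒜 : Deg n → Submodule ℝ A)

theorem mulLeft_mem_endHomogeneous [SetLike.GradedMonoid 𝒜] {φ : Deg n} {f : A} (hf : f ∈ 𝒜 φ) :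
    LinearMap.mulLeft ℝ f ∈ endHomogeneous 𝒜 φ := by
  intro δ a ha
  rw [add_comm]
  exact SetLike.mul_mem_graded hf ha

instance : SetLike.GradedMonoid (endHomogeneous 𝒜) where
  one_mem δ a ha := by simpa using ha
  mul_mem γ δ D E hD hE ε a ha := by
    rw [add_comm γ, ← add_assoc]
    exact hD _ _ (hE _ _ ha)

variable [GradedAlgebra 𝒜]

/-- The map `D ↦ D_γ` that sends an endomorphism to its component of degree `γ`, as a linear
map. -/
def endComponentHom (γ : Deg n) : Module.End ℝ A →ₗ[ℝ] Module.End ℝ A where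
  toFun := endComponent 𝒜 γ
  map_add' := endComponent_add 𝒜 γ
  map_smul' r D := by
    ext a
    simp [endComponent_apply, Finset.smul_sum]

theorem endComponent_smul_real (γ : Deg n) (r : ℝ) (D : Module.End ℝ A) :
    endComponent 𝒜 γ (r • D) = r • endComponent 𝒜 γ D :=
  map_smul (endComponentHom 𝒜 γ) r D

theorem endComponent_mem (γ : Deg n) (D : Module.End ℝ A) :
    endComponent 𝒜 γ D ∈ endHomogeneous 𝒜 γ := by
  intro δ a ha
  rw [endComponent_apply, Finset.sum_eq_single_of_mem δ (Finset.mem_univ δ)]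
  · exact proj_mem 𝒜 _ _
  · intro ε _ hε
    simp [proj_of_mem 𝒜 ha, hε]

theorem endComponent_of_mem {γ : Deg n} {D : Module.End ℝ A} (hD : D ∈ endHomogeneous 𝒜 γ)
    (δ : Deg n) : endComponent 𝒜 δ D = if δ = γ then D else 0 := by
  ext a
  have proj_apply_proj (ε : Deg n) :
      GradedAlgebra.proj 𝒜 (ε + δ) (D (GradedAlgebra.proj 𝒜 ε a)) =
        if δ = γ then D (GradedAlgebra.proj 𝒜 ε a) else 0 := by
    simp only [proj_of_mem 𝒜 (hD ε _ (proj_mem 𝒜 ε a)), add_right_inj]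
  simp only [endComponent_apply, proj_apply_proj]
  split_ifs
  · rw [← map_sum, sum_proj]
  · simp

/-- The graded commutator `[D, f]` of an endomorphism with the multiplication by `f`, as a bilinear
map in `f` and `D`. -/
def bracketMul : A →ₗ[ℝ] Module.End ℝ A →ₗ[ℝ] Module.End ℝ A :=
  LinearMap.mk₂ ℝ (fun f D => gradedCommutator 𝒜 D (LinearMap.mulLeft ℝ f))
    (fun f g D => by
      rw [← gradedCommutator_add_right]
      exact congrArg _ (LinearMap.ext fun a => add_mul f g a))
    (fun r f D => by
      have mulLeft_smul : LinearMap.mulLeft ℝ (r • f) = r • LinearMap.mulLeft ℝ f :=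
        LinearMap.ext fun a => smul_mul_assoc r f a
      simp only [mulLeft_smul, gradedCommutator, endComponent_smul_real, Finset.smul_sum, smul_sub,
        mul_smul_comm, smul_mul_assoc, smul_comm r])
    (fun f D E => gradedCommutator_add_left 𝒜 D E _)
    (fun r f D => by
      simp only [gradedCommutator, endComponent_smul_real, Finset.smul_sum, smul_sub,
        mul_smul_comm, smul_mul_assoc, smul_comm r])

theorem bracketMul_of_mem {γ φ : Deg n} {D : Module.End ℝ A} (hD : D ∈ endHomogeneous 𝒜 γ)
    {f : A} (hf : f ∈ 𝒜 φ) :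
    bracketMul 𝒜 f D = D * LinearMap.mulLeft ℝ f - sgn γ φ • (LinearMap.mulLeft ℝ f * D) := by
  change gradedCommutator 𝒜 D (LinearMap.mulLeft ℝ f) = _
  rw [gradedCommutator_mulLeft 𝒜 hf, Finset.sum_eq_single_of_mem γ (Finset.mem_univ γ)]
  · simp [endComponent_of_mem 𝒜 hD]
  · intro δ _ hδ
    simp [endComponent_of_mem 𝒜 hD, hδ]

theorem bracketMul_mem {γ φ : Deg n} {D : Module.End ℝ A} (hD : D ∈ endHomogeneous 𝒜 γ)
    {f : A} (hf : f ∈ 𝒜 φ) : bracketMul 𝒜 f D ∈ endHomogeneous 𝒜 (γ + φ) := by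
  have hmul := mulLeft_mem_endHomogeneous 𝒜 hf
  rw [bracketMul_of_mem 𝒜 hD hf]
  exact sub_mem (SetLike.mul_mem_graded hD hmul)
    (Submodule.smul_mem _ _ (add_comm φ γ ▸ SetLike.mul_mem_graded hmul hD))

theorem endComponent_bracketMul {φ : Deg n} {f : A} (hf : f ∈ 𝒜 φ) (D : Module.End ℝ A)
    (γ : Deg n) :
    endComponent 𝒜 (γ + φ) (bracketMul 𝒜 f D) = bracketMul 𝒜 f (endComponent 𝒜 γ D) := by
  conv_lhs => rw [← sum_endComponent 𝒜 D, map_sum]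
  change endComponentHom 𝒜 _ _ = _
  rw [map_sum, Finset.sum_eq_single_of_mem γ (Finset.mem_univ γ)]
  · exact (endComponent_of_mem 𝒜 (bracketMul_mem 𝒜 (endComponent_mem 𝒜 γ D) hf) _).trans
      (if_pos rfl)
  · intro δ _ hδ
    exact (endComponent_of_mem 𝒜 (bracketMul_mem 𝒜 (endComponent_mem 𝒜 δ D) hf) _).trans
      (if_neg fun h => hδ (add_right_cancel h).symm)

/-- The differential operators of order less than `k`. The shift of the index with respect to
`IsDiffOp` makes room for the zero space of operators of order `-1`, the start of inductions. -/
def orderLT : ℕ → Submodule ℝ (Module.End ℝ A)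
  | 0 => ⊥
  | k + 1 => ⨅ f, (orderLT k).comap (bracketMul 𝒜 f)

theorem mem_orderLT_zero {D : Module.End ℝ A} : D ∈ orderLT 𝒜 0 ↔ D = 0 :=
  Submodule.mem_bot ℝ

theorem mem_orderLT_succ {k : ℕ} {D : Module.End ℝ A} :
    D ∈ orderLT 𝒜 (k + 1) ↔ ∀ f, bracketMul 𝒜 f D ∈ orderLT 𝒜 k := by
  simp [orderLT]

theorem mem_orderLT_succ_of_homogeneous {k : ℕ} {D : Module.End ℝ A}
    (h : ∀ φ, ∀ f ∈ 𝒜 φ, bracketMul 𝒜 f D ∈ orderLT 𝒜 k) : D ∈ orderLT 𝒜 (k + 1) := by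
  refine (mem_orderLT_succ 𝒜).2 fun f => ?_
  induction f using DirectSum.Decomposition.inductionOn 𝒜 with
  | zero => simp
  | homogeneous f => exact h _ _ f.2
  | add f g hf hg =>
    rw [map_add]
    exact add_mem hf hg

theorem isDiffOp_iff_mem_orderLT {k : ℕ} {D : Module.End ℝ A} :
    IsDiffOp 𝒜 k D ↔ D ∈ orderLT 𝒜 (k + 1) := by
  induction k generalizing D with
  | zero => exact (forall_congr' fun f => (mem_orderLT_zero 𝒜).symm).trans (mem_orderLT_succ 𝒜).symm
  | succ k ih => exact (forall_congr' fun f => ih).trans (mem_orderLT_succ 𝒜).symm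

theorem orderLT_mono : Monotone (orderLT 𝒜) := by
  refine monotone_nat_of_le_succ fun k => ?_
  induction k with
  | zero => exact bot_le
  | succ k ih =>
    exact fun D hD => (mem_orderLT_succ 𝒜).2 fun f => ih ((mem_orderLT_succ 𝒜).1 hD f)

variable {𝒜}

theorem endComponent_mem_orderLT {k : ℕ} {D : Module.End ℝ A} (hD : D ∈ orderLT 𝒜 k)
    (γ : Deg n) : endComponent 𝒜 γ D ∈ orderLT 𝒜 k := by
  induction k generalizing D γ with
  | zero =>
    rw [mem_orderLT_zero] at hD ⊢
    rw [hD]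
    exact map_zero (endComponentHom 𝒜 γ)
  | succ k ih =>
    refine mem_orderLT_succ_of_homogeneous 𝒜 fun φ f hf => ?_
    rw [← endComponent_bracketMul 𝒜 hf]
    exact ih ((mem_orderLT_succ 𝒜).1 hD f) _

theorem smul_mem_orderLT (h𝒜 : GradedCommutative 𝒜) {k : ℕ} {D : Module.End ℝ A}
    (hD : D ∈ orderLT 𝒜 k) (f : A) : f • D ∈ orderLT 𝒜 k := by
  cases k with
  | zero => rw [mem_orderLT_zero] at hD ⊢; rw [hD, smul_zero]
  | succ k =>
    rw [← isDiffOp_iff_mem_orderLT] at hD ⊢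
    exact (diffOp h𝒜 k).smul_mem f hD

theorem bracketMul_mul {γ δ φ : Deg n} {D E : Module.End ℝ A} (hD : D ∈ endHomogeneous 𝒜 γ)
    (hE : E ∈ endHomogeneous 𝒜 δ) {f : A} (hf : f ∈ 𝒜 φ) :
    bracketMul 𝒜 f (D * E) = D * bracketMul 𝒜 f E + sgn δ φ • (bracketMul 𝒜 f D * E) := by
  rw [bracketMul_of_mem 𝒜 (SetLike.mul_mem_graded hD hE) hf, bracketMul_of_mem 𝒜 hD hf,
    bracketMul_of_mem 𝒜 hE hf, mul_sub, sub_mul, smul_sub, sgn_add_left, smul_mul_assoc, smul_smul,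
    mul_smul_comm, mul_comm (sgn γ φ)]
  simp only [mul_assoc]
  abel

theorem mul_mem_orderLT_of_homogeneous {k l m : ℕ} {γ δ : Deg n} {D E : Module.End ℝ A}
    (hDγ : D ∈ endHomogeneous 𝒜 γ) (hEδ : E ∈ endHomogeneous 𝒜 δ) (hD : D ∈ orderLT 𝒜 k)
    (hE : E ∈ orderLT 𝒜 l) (hm : k + l ≤ m + 1) : D * E ∈ orderLT 𝒜 m := by
  induction m generalizing k l γ δ D E with
  | zero =>
    obtain rfl | rfl : k = 0 ∨ l = 0 := by omega
    · simp [(mem_orderLT_zero 𝒜).1 hD]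
    · simp [(mem_orderLT_zero 𝒜).1 hE]
  | succ m ih =>
    refine mem_orderLT_succ_of_homogeneous 𝒜 fun φ f hf => ?_
    rw [bracketMul_mul hDγ hEδ hf]
    refine add_mem ?_ (Submodule.smul_mem _ _ ?_)
    · cases l with
      | zero => simp [(mem_orderLT_zero 𝒜).1 hE]
      | succ l =>
        exact ih hDγ (bracketMul_mem 𝒜 hEδ hf) hD ((mem_orderLT_succ 𝒜).1 hE f) (by omega)
    · cases k with
      | zero => simp [(mem_orderLT_zero 𝒜).1 hD]
      | succ k =>
        exact ih (bracketMul_mem 𝒜 hDγ hf) hEδ ((mem_orderLT_succ 𝒜).1 hD f) hE (by omega)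

theorem mul_mem_orderLT {k l m : ℕ} {D E : Module.End ℝ A} (hD : D ∈ orderLT 𝒜 k)
    (hE : E ∈ orderLT 𝒜 l) (hm : k + l ≤ m + 1) : D * E ∈ orderLT 𝒜 m := by
  rw [← sum_endComponent 𝒜 D, ← sum_endComponent 𝒜 E, Finset.sum_mul_sum]
  exact sum_mem fun γ _ => sum_mem fun δ _ =>
    mul_mem_orderLT_of_homogeneous (endComponent_mem 𝒜 γ D) (endComponent_mem 𝒜 δ E)
      (endComponent_mem_orderLT hD γ) (endComponent_mem_orderLT hE δ) hm

theorem one_mem_orderLT : (1 : Module.End ℝ A) ∈ orderLT 𝒜 1 := by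
  refine mem_orderLT_succ_of_homogeneous 𝒜 fun φ f hf => (mem_orderLT_zero 𝒜).2 ?_
  rw [bracketMul_of_mem 𝒜 SetLike.GradedOne.one_mem hf, sgn_zero_left, one_smul, one_mul, mul_one,
    sub_self]

theorem pow_mem_orderLT {D : Module.End ℝ A} (hD : D ∈ orderLT 𝒜 2) (m : ℕ) :
    D ^ m ∈ orderLT 𝒜 (m + 1) := by
  induction m with
  | zero => exact one_mem_orderLT
  | succ m ih => exact pow_succ D m ▸ mul_mem_orderLT ih hD le_rfl

theorem list_prod_pow_mem_orderLT {ι : Type*} {P : ι → Module.End ℝ A}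
    (hP : ∀ a, P a ∈ orderLT 𝒜 2) (i : ι → ℕ) (L : List ι) :
    (L.map fun a => P a ^ i a).prod ∈ orderLT 𝒜 ((L.map i).sum + 1) := by
  induction L with
  | nil => exact one_mem_orderLT
  | cons a L ih =>
    simp only [List.map_cons, List.prod_cons, List.sum_cons]
    exact mul_mem_orderLT (pow_mem_orderLT (hP a) (i a)) ih (by omega)

theorem mem_orderLT_two_of_leibniz (h𝒜 : GradedCommutative 𝒜) {γ : Deg n} {D : Module.End ℝ A}
    (hD : D ∈ endHomogeneous 𝒜 γ)
    (leibniz : ∀ φ, ∀ f ∈ 𝒜 φ, ∀ g, D (f * g) = D f * g + sgn γ φ • (f * D g)) :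
    D ∈ orderLT 𝒜 2 := by
  refine mem_orderLT_succ_of_homogeneous 𝒜 fun φ f hf => ?_
  have bracket_eq : bracketMul 𝒜 f D = D f • 1 := by
    ext g
    simp [bracketMul_of_mem 𝒜 hD hf, leibniz φ f hf]
  exact bracket_eq ▸ smul_mem_orderLT h𝒜 one_mem_orderLT _

theorem isInternal_diffOp (h𝒜 : GradedCommutative 𝒜) (k : ℕ) :
    DirectSum.IsInternal fun γ : Deg n =>
      (endHomogeneous 𝒜 γ).comap ((diffOp h𝒜 k).subtype.restrictScalars ℝ) := by
  have component_mem (γ : Deg n) : ∀ D ∈ (diffOp h𝒜 k).restrictScalars ℝ,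
      endComponentHom 𝒜 γ D ∈ (diffOp h𝒜 k).restrictScalars ℝ := fun D hD =>
    (isDiffOp_iff_mem_orderLT 𝒜).2 (endComponent_mem_orderLT ((isDiffOp_iff_mem_orderLT 𝒜).1 hD) γ)
  refine isInternal_of_projections _ (fun γ => (endComponentHom 𝒜 γ).restrict (component_mem γ))
    (fun γ D => endComponent_mem 𝒜 γ D.1) (fun D => Subtype.ext ?_)
    fun γ δ D hD => Subtype.ext ((endComponent_of_mem 𝒜 hD γ).trans ?_)
  · rw [AddSubmonoidClass.coe_finsetSum]
    exact sum_endComponent 𝒜 D.1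
  · split_ifs <;> rfl

end OrderFiltration

/-! ### Graded coordinates and bases of operators -/

section Triangular

variable {I R N : Type*} [Finite I] [Ring R] [AddCommGroup N] [Module R N] {deg : I → ℕ} {e : I → N}
  {ev : I → N →ₗ[R] R}

theorem linearIndependent_of_triangular
    (triangular : ∀ i j, i ≠ j → deg j ≤ deg i → ev j (e i) = 0)
    (diagonal : ∀ i, IsUnit (ev i (e i))) : LinearIndependent R e := by
  cases nonempty_fintype I
  refine Fintype.linearIndependent_iff.2 fun c hc j => ?_
  induction hm : deg j using Nat.strong_induction_on generalizing j with
  | _ m ih =>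
    have eval_sum : ∑ i, c i * ev j (e i) = 0 := by simpa using congrArg (ev j) hc
    rw [Fintype.sum_eq_single j fun i hij => ?_] at eval_sum
    · exact (diagonal j).mul_left_eq_zero.1 eval_sum
    · rcases lt_or_ge (deg i) (deg j) with hlt | hge
      · rw [ih _ (hm ▸ hlt) i rfl, zero_mul]
      · rw [triangular i j hij hge, mul_zero]

theorem exists_mem_span_forall_eq_of_triangular
    (triangular : ∀ i j, i ≠ j → deg j ≤ deg i → ev j (e i) = 0)
    (diagonal : ∀ i, IsUnit (ev i (e i))) (D : N) (m : ℕ) :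
    ∃ T ∈ Submodule.span R (Set.range e), ∀ j, deg j < m → ev j T = ev j D := by
  cases nonempty_fintype I
  induction m with
  | zero => exact ⟨0, zero_mem _, fun j hj => absurd hj (Nat.not_lt_zero _)⟩
  | succ m ih =>
    obtain ⟨T, hT, eval_T⟩ := ih
    let c (i : I) : R := (ev i D - ev i T) * Ring.inverse (ev i (e i))
    refine ⟨T + ∑ i with deg i = m, c i • e i, add_mem hT (sum_mem fun i _ =>
      Submodule.smul_mem _ _ (Submodule.subset_span ⟨i, rfl⟩)), fun j hj => ?_⟩
    simp only [map_add, map_sum, map_smul, smul_eq_mul]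
    have off_diagonal {i : I} (hi : deg i = m) (hij : i ≠ j) : c i * ev j (e i) = 0 := by
      rw [triangular i j hij (by omega), mul_zero]
    rcases Nat.lt_succ_iff_lt_or_eq.1 hj with hlt | heq
    · rw [Finset.sum_eq_zero fun i hi => ?_, add_zero, eval_T j hlt]
      have hi : deg i = m := (Finset.mem_filter.1 hi).2
      exact off_diagonal hi (by rintro rfl; omega)
    · rw [Finset.sum_eq_single_of_mem j (by simpa using heq) fun i hi =>
        off_diagonal (Finset.mem_filter.1 hi).2]
      rw [mul_assoc, Ring.inverse_mul_cancel _ (diagonal j), mul_one, add_sub_cancel]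

theorem exists_basis_of_triangular
    (triangular : ∀ i j, i ≠ j → deg j ≤ deg i → ev j (e i) = 0)
    (diagonal : ∀ i, IsUnit (ev i (e i))) (separating : ∀ D, (∀ j, ev j D = 0) → D = 0) :
    ∃ b : Module.Basis I R N, ∀ i, b i = e i := by
  cases nonempty_fintype I
  have span_eq_top : ⊤ ≤ Submodule.span R (Set.range e) := by
    rintro D -
    obtain ⟨T, hT, eval_T⟩ := exists_mem_span_forall_eq_of_triangular triangular diagonal D
      (Finset.univ.sup deg + 1)
    have eval_sub (j : I) : ev j (D - T) = 0 := by
      rw [map_sub, eval_T j (Nat.lt_succ_of_le (Finset.le_sup (Finset.mem_univ j))), sub_self]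
    rwa [sub_eq_zero.1 (separating (D - T) eval_sub)]
  exact ⟨.mk (linearIndependent_of_triangular triangular diagonal) span_eq_top,
    fun i => Module.Basis.mk_apply _ _ i⟩

end Triangular

theorem list_sum_map_eq_sum {ι M : Type*} [Fintype ι] [AddCommMonoid M] {L : List ι}
    (hL : L.Nodup) (hL' : ∀ a, a ∈ L) (f : ι → M) : (L.map f).sum = ∑ a, f a := by
  classical
  rw [← List.sum_toFinset f hL, Finset.eq_univ_iff_forall.2 fun a => List.mem_toFinset.2 (hL' a)]

theorem perm_flatMap_replicate_count {ι : Type*} [DecidableEq ι] {L : List ι} (hL : L.Nodup)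
    (hL' : ∀ a, a ∈ L) (w : List ι) : w.Perm (L.flatMap fun a => List.replicate (w.count a) a) := by
  refine List.perm_iff_count.2 fun b => ?_
  have count_replicate : (List.count b ∘ fun a => List.replicate (w.count a) a) =
      Pi.single b (w.count b) := by
    ext a
    rcases eq_or_ne a b with rfl | hab
    · simp
    · simp [hab, List.count_replicate]
  rw [List.count_flatMap, count_replicate, ← List.sum_toFinset _ hL,
    Finset.sum_eq_single_of_mem b (List.mem_toFinset.2 (hL' b)) fun a _ hab =>
      Pi.single_eq_of_ne hab _, Pi.single_eq_same]

/-- Coordinates of a graded algebra: homogeneous elements `coord a` and graded derivations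
`pderiv a` dual to them, such that a homogeneous operator which commutes with the multiplications by
all coordinates and annihilates the unit vanishes. -/
structure GradedCoordinates {n : ℕ} {A : Type*} [Ring A] [Algebra ℝ A]
    (𝒜 : Deg n → Submodule ℝ A) {ι : Type*} [DecidableEq ι] (d : ι → Deg n) where
  /-- The coordinates. -/
  coord : ι → A
  /-- The partial derivatives. -/
  pderiv : ι → Module.End ℝ A
  coord_mem : ∀ a, coord a ∈ 𝒜 (d a)
  pderiv_mem : ∀ a, pderiv a ∈ endHomogeneous 𝒜 (d a)
  leibniz : ∀ a φ, ∀ f ∈ 𝒜 φ, ∀ g,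
    pderiv a (f * g) = pderiv a f * g + sgn (d a) φ • (f * pderiv a g)
  pderiv_coord : ∀ a b, pderiv a (coord b) = if a = b then 1 else 0
  rigid : ∀ γ, ∀ E ∈ endHomogeneous 𝒜 γ,
    (∀ a f, E (coord a * f) = sgn γ (d a) • (coord a * E f)) → E 1 = 0 → E = 0

namespace GradedCoordinates

variable {n : ℕ} {A : Type*} [Ring A] [Algebra ℝ A] {𝒜 : Deg n → Submodule ℝ A} {ι : Type*}
  [DecidableEq ι] {d : ι → Deg n} (C : GradedCoordinates 𝒜 d)

/-- The product of the coordinates in a list. -/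
def word (w : List ι) : A := (w.map C.coord).prod

/-- The monomial with exponents `j` in the coordinates, ordered as in a list. -/
def mono (L : List ι) (j : ι → ℕ) : A := (L.map fun a => C.coord a ^ j a).prod

/-- The iterated derivative with exponents `i`, in the order opposite to that of a list. -/
def diff (L : List ι) (i : ι → ℕ) : Module.End ℝ A :=
  (L.reverse.map fun a => C.pderiv a ^ i a).prod

theorem word_cons (a : ι) (w : List ι) : C.word (a :: w) = C.coord a * C.word w := rfl

theorem mono_cons (a : ι) (L : List ι) (j : ι → ℕ) :
    C.mono (a :: L) j = C.coord a ^ j a * C.mono L j := rfl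

theorem diff_cons (a : ι) (L : List ι) (i : ι → ℕ) :
    C.diff (a :: L) i = C.diff L i * C.pderiv a ^ i a := by
  simp [diff]

theorem word_mem [SetLike.GradedMonoid 𝒜] (w : List ι) : C.word w ∈ 𝒜 (w.map d).sum :=
  SetLike.list_prod_map_mem_graded w _ _ fun a _ => C.coord_mem a

theorem word_flatMap_replicate (L : List ι) (j : ι → ℕ) :
    C.word (L.flatMap fun a => List.replicate (j a) a) = C.mono L j := by
  induction L with
  | nil => rfl
  | cons a L ih => simpa [word, mono] using congrArg (C.coord a ^ j a * ·) ih

section Derivatives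

theorem pderiv_one [SetLike.GradedMonoid 𝒜] (a : ι) : C.pderiv a 1 = 0 := by
  simpa [sgn_zero_right] using C.leibniz a 0 1 SetLike.GradedOne.one_mem 1

theorem pderiv_coord_mul (a b : ι) (g : A) :
    C.pderiv a (C.coord b * g) =
      (if a = b then g else 0) + sgn (d a) (d b) • (C.coord b * C.pderiv a g) := by
  rw [C.leibniz a (d b) _ (C.coord_mem b), C.pderiv_coord]
  split_ifs <;> simp

theorem pderiv_coord_pow_mul_of_ne {a b : ι} (h : a ≠ b) (m : ℕ) (g : A) :
    C.pderiv a (C.coord b ^ m * g) = sgn (d a) (d b) ^ m • (C.coord b ^ m * C.pderiv a g) := by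
  induction m with
  | zero => simp
  | succ m ih =>
    rw [pow_succ', mul_assoc, C.pderiv_coord_mul, if_neg h, ih, zero_add, mul_smul_comm, smul_smul,
      pow_succ', mul_assoc]

theorem pderiv_pow_coord_pow_mul_of_ne {a b : ι} (h : a ≠ b) (l m : ℕ) (g : A) :
    (C.pderiv a ^ l) (C.coord b ^ m * g) =
      (sgn (d a) (d b) ^ m) ^ l • (C.coord b ^ m * (C.pderiv a ^ l) g) := by
  induction l with
  | zero => simp
  | succ l ih =>
    rw [pow_succ', Module.End.mul_apply, ih, map_smul, C.pderiv_coord_pow_mul_of_ne h, smul_smul,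
      Module.End.mul_apply, pow_succ]

theorem diff_coord_pow_mul {b : ι} {L : List ι} (h : b ∉ L) (i : ι → ℕ) (m : ℕ) (g : A) :
    C.diff L i (C.coord b ^ m * g) =
      (L.map fun a => (sgn (d a) (d b) ^ m) ^ i a).prod • (C.coord b ^ m * C.diff L i g) := by
  induction L generalizing g with
  | nil => simp [diff]
  | cons a L ih =>
    obtain ⟨hba, hbL⟩ := not_or.1 (mt List.mem_cons.2 h)
    rw [diff_cons, Module.End.mul_apply, C.pderiv_pow_coord_pow_mul_of_ne (Ne.symm hba), map_smul,
      ih hbL, smul_smul, Module.End.mul_apply, List.map_cons, List.prod_cons]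

theorem pderiv_mono_of_notMem [SetLike.GradedMonoid 𝒜] {a : ι} {L : List ι} (h : a ∉ L)
    (j : ι → ℕ) : C.pderiv a (C.mono L j) = 0 := by
  induction L with
  | nil => simpa [mono] using C.pderiv_one a
  | cons b L ih =>
    obtain ⟨hab, haL⟩ := not_or.1 (mt List.mem_cons.2 h)
    rw [mono_cons, C.pderiv_coord_pow_mul_of_ne hab, ih haL, mul_zero, smul_zero]

theorem pderiv_coord_pow_mul_self {a : ι} {g : A} (hg : C.pderiv a g = 0) (j : ℕ) :
    C.pderiv a (C.coord a ^ j * g) =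
      (∑ m ∈ Finset.range j, sgn (d a) (d a) ^ m) • (C.coord a ^ (j - 1) * g) := by
  induction j with
  | zero => simp [hg]
  | succ j ih =>
    rw [pow_succ', mul_assoc, C.pderiv_coord_mul, if_pos rfl, ih, geom_sum_succ, add_smul, one_smul,
      mul_smul_comm, smul_smul, Nat.add_sub_cancel, add_comm]
    cases j with
    | zero => simp
    | succ j => rw [← mul_assoc, ← pow_succ', Nat.add_sub_cancel]

theorem pderiv_pow_coord_pow_mul_self {a : ι} {g : A} (hg : C.pderiv a g = 0) (i j : ℕ) :
    (C.pderiv a ^ i) (C.coord a ^ j * g) =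
      (∏ l ∈ Finset.range i, ∑ m ∈ Finset.range (j - l), sgn (d a) (d a) ^ m) •
        (C.coord a ^ (j - i) * g) := by
  induction i with
  | zero => simp
  | succ i ih =>
    rw [pow_succ', Module.End.mul_apply, ih, map_smul, C.pderiv_coord_pow_mul_self hg, smul_smul,
      Finset.prod_range_succ, Nat.sub_sub]

theorem diff_mono_of_lt [SetLike.GradedMonoid 𝒜] {L : List ι} (hL : L.Nodup) {i j : ι → ℕ} {a : ι}
    (ha : a ∈ L) (h : j a < i a) : C.diff L i (C.mono L j) = 0 := by
  induction L with
  | nil => simp at ha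
  | cons b L ih =>
    obtain ⟨hbL, hL⟩ := List.nodup_cons.1 hL
    rw [diff_cons, mono_cons, Module.End.mul_apply,
      C.pderiv_pow_coord_pow_mul_self (C.pderiv_mono_of_notMem hbL j), map_smul]
    rcases List.mem_cons.1 ha with rfl | ha
    · rw [Finset.prod_eq_zero (Finset.mem_range.2 h) (by simp), zero_smul]
    · rw [C.diff_coord_pow_mul hbL, ih hL ha, mul_zero, smul_zero, smul_zero]

theorem isUnit_diff_mono_self [SetLike.GradedMonoid 𝒜] {L : List ι} (hL : L.Nodup) {i : ι → ℕ}
    (hi : ∀ a, IsOdd (d a) → i a ≤ 1) : IsUnit (C.diff L i (C.mono L i)) := by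
  induction L with
  | nil => simp [diff, mono]
  | cons b L ih =>
    obtain ⟨hbL, hL⟩ := List.nodup_cons.1 hL
    rw [diff_cons, mono_cons, Module.End.mul_apply,
      C.pderiv_pow_coord_pow_mul_self (C.pderiv_mono_of_notMem hbL i), map_smul, Nat.sub_self,
      pow_zero, one_mul, Algebra.smul_def]
    refine (IsUnit.map _ (Finset.prod_ne_zero_iff.2 fun l hl => ?_).isUnit).mul (ih hL)
    rw [Finset.mem_range] at hl
    exact geom_sum_sgn_self_ne_zero (by omega) fun hb => (Nat.sub_le _ _).trans (hi b hb)

end Derivatives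

section Words

theorem exists_word_eq_smul_of_perm (h𝒜 : GradedCommutative 𝒜) {w w' : List ι} (h : w.Perm w') :
    ∃ r : ℝ, C.word w = r • C.word w' := by
  induction h with
  | nil => exact ⟨1, (one_smul ℝ _).symm⟩
  | cons a _ ih =>
    obtain ⟨r, hr⟩ := ih
    exact ⟨r, by rw [word_cons, word_cons, hr, mul_smul_comm]⟩
  | swap a b w =>
    refine ⟨sgn (d b) (d a), ?_⟩
    simp only [word_cons]
    rw [← mul_assoc, ← mul_assoc, h𝒜 _ _ _ (C.coord_mem b) _ (C.coord_mem a), smul_mul_assoc]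
  | trans _ _ ih₁ ih₂ =>
    obtain ⟨r, hr⟩ := ih₁
    obtain ⟨s, hs⟩ := ih₂
    exact ⟨r * s, by rw [hr, hs, smul_smul]⟩

theorem coord_sq_of_isOdd (h𝒜 : GradedCommutative 𝒜) {a : ι} (ha : IsOdd (d a)) :
    C.coord a ^ 2 = 0 := by
  have anticommute := h𝒜 _ _ _ (C.coord_mem a) _ (C.coord_mem a)
  rw [sgn_self_of_isOdd ha, neg_one_smul, eq_neg_iff_add_eq_zero, ← two_smul ℝ] at anticommute
  rw [sq]
  exact (smul_eq_zero.1 anticommute).resolve_left two_ne_zero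

theorem mono_eq_zero_of_isOdd (h𝒜 : GradedCommutative 𝒜) {a : ι} (ha : IsOdd (d a)) {L : List ι}
    (haL : a ∈ L) {j : ι → ℕ} (hj : 2 ≤ j a) : C.mono L j = 0 := by
  refine List.prod_eq_zero (List.mem_map.2 ⟨a, haL, ?_⟩)
  rw [← Nat.sub_add_cancel hj, pow_add, C.coord_sq_of_isOdd h𝒜 ha, mul_zero]

variable [GradedAlgebra 𝒜]

theorem eq_zero_of_word_of_mem {k : ℕ} {γ : Deg n} {D : Module.End ℝ A}
    (hD : D ∈ endHomogeneous 𝒜 γ) (hk : D ∈ orderLT 𝒜 k)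
    (h : ∀ w : List ι, w.length < k → D (C.word w) = 0) : D = 0 := by
  induction k generalizing γ D with
  | zero => exact (mem_orderLT_zero 𝒜).1 hk
  | succ k ih =>
    refine C.rigid γ D hD (fun a f => ?_) (h [] (by simp))
    have bracket_eq_zero : bracketMul 𝒜 (C.coord a) D = 0 := by
      refine ih (bracketMul_mem 𝒜 hD (C.coord_mem a)) ((mem_orderLT_succ 𝒜).1 hk _) fun w hw => ?_
      have apply_word_cons : D (C.coord a * C.word w) = 0 := h (a :: w) (by simpa using hw)
      simp [bracketMul_of_mem 𝒜 hD (C.coord_mem a), apply_word_cons, h w (by omega)]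
    rw [bracketMul_of_mem 𝒜 hD (C.coord_mem a), sub_eq_zero] at bracket_eq_zero
    exact LinearMap.congr_fun bracket_eq_zero f

theorem eq_zero_of_word {k : ℕ} {D : Module.End ℝ A} (hk : D ∈ orderLT 𝒜 k)
    (h : ∀ w : List ι, w.length < k → D (C.word w) = 0) : D = 0 := by
  rw [← sum_endComponent 𝒜 D]
  refine Finset.sum_eq_zero fun γ _ => C.eq_zero_of_word_of_mem (endComponent_mem 𝒜 γ D)
    (endComponent_mem_orderLT hk γ) fun w hw => ?_
  simp only [endComponent_apply, proj_of_mem 𝒜 (C.word_mem w), apply_ite D, h w hw, map_zero,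
    ite_self, Finset.sum_const_zero]

theorem eq_zero_of_mono (h𝒜 : GradedCommutative 𝒜) [Fintype ι] {L : List ι} (hL : L.Nodup)
    (hL' : ∀ a, a ∈ L) {k : ℕ} {D : Module.End ℝ A} (hk : D ∈ orderLT 𝒜 k)
    (h : ∀ j : ι → ℕ, (∀ a, IsOdd (d a) → j a ≤ 1) → ∑ a, j a < k → D (C.mono L j) = 0) :
    D = 0 := by
  refine C.eq_zero_of_word hk fun w hw => ?_
  obtain ⟨r, hr⟩ := C.exists_word_eq_smul_of_perm h𝒜 (perm_flatMap_replicate_count hL hL' w)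
  rw [hr, map_smul, C.word_flatMap_replicate]
  by_cases hodd : ∀ a, IsOdd (d a) → w.count a ≤ 1
  · have sum_count : ∑ a, w.count a = w.length := by
      simpa using Multiset.sum_count_eq_card (m := (w : Multiset ι)) fun a _ => Finset.mem_univ a
    rw [h _ hodd (sum_count.trans_lt hw), smul_zero]
  · push Not at hodd
    obtain ⟨a, ha, two_le⟩ := hodd
    rw [C.mono_eq_zero_of_isOdd h𝒜 ha (hL' a) two_le, map_zero, smul_zero]

end Words

theorem diff_mem_orderLT [GradedAlgebra 𝒜] (h𝒜 : GradedCommutative 𝒜) (L : List ι) (i : ι → ℕ) :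
    C.diff L i ∈ orderLT 𝒜 ((L.map i).sum + 1) := by
  have := list_prod_pow_mem_orderLT
    (fun a => mem_orderLT_two_of_leibniz h𝒜 (C.pderiv_mem a) (C.leibniz a)) i L.reverse
  rwa [List.map_reverse, List.sum_reverse] at this

theorem diff_mem_endHomogeneous (L : List ι) (i : ι → ℕ) :
    C.diff L i ∈ endHomogeneous 𝒜 (L.map fun a => i a • d a).sum := by
  have := SetLike.list_prod_map_mem_graded (A := endHomogeneous 𝒜) L.reverse
    (fun a => i a • d a) _ fun a _ => SetLike.pow_mem_graded (i a) (C.pderiv_mem a)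
  rwa [List.map_reverse, List.sum_reverse] at this

theorem exists_basis [GradedAlgebra 𝒜] (h𝒜 : GradedCommutative 𝒜) [Fintype ι] {L : List ι}
    (hL : L.Nodup) (hL' : ∀ a, a ∈ L) {k : ℕ} {I : Type*} [Finite I] {idx : I → ι → ℕ}
    (hidx : Function.Injective idx)
    (hrange : ∀ j, (∃ i, idx i = j) ↔ (∀ a, IsOdd (d a) → j a ≤ 1) ∧ ∑ a, j a ≤ k)
    (e : I → diffOp h𝒜 k) (he : ∀ i, (e i).1 = C.diff L (idx i)) :
    ∃ b : Module.Basis I A (diffOp h𝒜 k), ∀ i, b i = e i := by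
  let evalMono (i : I) : diffOp h𝒜 k →ₗ[A] A :=
    { toFun := fun D => D.1 (C.mono L (idx i))
      map_add' := fun _ _ => rfl
      map_smul' := fun _ _ => rfl }
  have evalMono_basis (i j : I) : evalMono j (e i) = C.diff L (idx i) (C.mono L (idx j)) :=
    LinearMap.congr_fun (he i) _
  refine exists_basis_of_triangular (R := A) (N := diffOp h𝒜 k) (ev := evalMono)
    (deg := fun i => ∑ a, idx i a) (fun i j hij hle => ?_) (fun i => ?_) fun D hD => Subtype.ext ?_
  · obtain ⟨a, ha⟩ : ∃ a, idx j a < idx i a := by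
      by_contra! hge
      exact (Fintype.sum_strictMono (lt_of_le_of_ne hge (hidx.ne hij))).not_ge hle
    exact (evalMono_basis i j).trans (C.diff_mono_of_lt hL (hL' a) ha)
  · rw [evalMono_basis]
    exact C.isUnit_diff_mono_self hL ((hrange _).1 ⟨i, rfl⟩).1
  · refine C.eq_zero_of_mono h𝒜 hL hL' ((isDiffOp_iff_mem_orderLT 𝒜).1 D.2) fun j hodd hsum => ?_
    obtain ⟨i, rfl⟩ := (hrange j).2 ⟨hodd, Nat.lt_succ_iff.1 hsum⟩
    exact hD i

end GradedCoordinates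

/-! ### Formal power series -/

namespace Series

open Finset.HasAntidiagonal (antidiagonal mem_antidiagonal)
open Finsupp (single)

section Exponents

theorem exists_eq_add_single {ι : Type*} {α : ι →₀ ℕ} {a : ι} (h : α a ≠ 0) :
    ∃ β, α = β + single a 1 :=
  ⟨α - single a 1, (tsub_add_cancel_of_le
    (Finsupp.single_le_iff.2 (Nat.one_le_iff_ne_zero.2 h))).symm⟩

variable {ι : Type*} [DecidableEq ι]

theorem sum_antidiagonal_add_single_left {M : Type*} [AddCommMonoid M] (a : ι) (γ : ι →₀ ℕ)
    (F : (ι →₀ ℕ) → (ι →₀ ℕ) → M) (hF : ∀ μ ν, μ a = 0 → F μ ν = 0) :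
    ∑ p ∈ antidiagonal γ, F (p.1 + single a 1) p.2 =
      ∑ p ∈ antidiagonal (γ + single a 1), F p.1 p.2 := by
  refine Finset.sum_of_injOn (fun p => (p.1 + single a 1, p.2)) ?_ ?_ ?_ fun p _ => rfl
  · rintro ⟨μ, ν⟩ _ ⟨μ', ν'⟩ _ h
    simpa using h
  · rintro ⟨μ, ν⟩ h
    simp only [Finset.mem_coe, mem_antidiagonal] at h ⊢
    rw [← h, add_right_comm]
  · rintro ⟨μ, ν⟩ h hμ
    refine hF _ _ (by_contra fun ha => hμ ?_)
    obtain ⟨μ, rfl⟩ := exists_eq_add_single ha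
    refine ⟨(μ, ν), ?_, rfl⟩
    simp only [Finset.mem_coe, mem_antidiagonal] at h ⊢
    rwa [add_right_comm, add_left_inj] at h

theorem sum_antidiagonal_add_single_right {M : Type*} [AddCommMonoid M] (a : ι) (γ : ι →₀ ℕ)
    (F : (ι →₀ ℕ) → (ι →₀ ℕ) → M) (hF : ∀ μ ν, ν a = 0 → F μ ν = 0) :
    ∑ p ∈ antidiagonal γ, F p.1 (p.2 + single a 1) =
      ∑ p ∈ antidiagonal (γ + single a 1), F p.1 p.2 := by
  have sum_swap (α : ι →₀ ℕ) (G : (ι →₀ ℕ) → (ι →₀ ℕ) → M) :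
      ∑ p ∈ antidiagonal α, G p.1 p.2 = ∑ p ∈ antidiagonal α, G p.2 p.1 :=
    Finset.sum_nbij' Prod.swap Prod.swap (by simp [add_comm]) (by simp [add_comm]) (by simp)
      (by simp) (by simp)
  rw [sum_swap γ fun μ ν => F μ (ν + single a 1), sum_swap _ F]
  exact sum_antidiagonal_add_single_left a γ (fun μ ν => F ν μ) fun μ ν h => hF ν μ h

end Exponents

variable {n : ℕ} {ι : Type} {d : ι → Deg n}

theorem admissible_zero : Admissible d 0 := fun _ _ => Nat.zero_le 1

theorem admissible_single (a : ι) : Admissible d (single a 1) := fun b _ => by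
  classical
  rw [Finsupp.single_apply]
  split_ifs <;> exact Nat.le_of_ble_eq_true rfl

theorem admissible_add_single_iff {γ : ι →₀ ℕ} (hγ : Admissible d γ) (a : ι) :
    Admissible d (γ + single a 1) ↔ (IsOdd (d a) → γ a = 0) := by
  refine ⟨fun h hodd => by simpa using h a hodd, fun h b hb => ?_⟩
  rcases eq_or_ne b a with rfl | hba
  · simp [h hb]
  · simpa [Finsupp.single_eq_of_ne hba] using hγ b hb

section Coefficient

variable {R : Type} [CommRing R]

theorem coeff_of_not_admissible {α : ι →₀ ℕ} (h : ¬ Admissible d α) (f : Series d R) :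
    coeff α f = 0 := by
  simp [coeff, h]

theorem coeff_of_admissible {α : ι →₀ ℕ} (h : Admissible d α) (f : Series d R) :
    coeff α f = f ⟨α, h⟩ := by
  simp [coeff, h]

/-- The variable `ξ_a`. -/
def var [DecidableEq ι] (a : ι) : Series d R := fun α => if α.1 = single a 1 then 1 else 0

theorem coeff_var [DecidableEq ι] (a : ι) (α : ι →₀ ℕ) :
    coeff α (var a : Series d R) = if α = single a 1 then 1 else 0 := by
  by_cases h : Admissible d α
  · rw [coeff_of_admissible h]
    rfl
  · rw [coeff_of_not_admissible h, if_neg]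
    rintro rfl
    exact h (admissible_single a)

end Coefficient

section Degree

variable [Fintype ι]

theorem monDeg_add (α β : ι →₀ ℕ) : monDeg d (α + β) = monDeg d α + monDeg d β := by
  simp [monDeg, add_smul, Finset.sum_add_distrib]

theorem monDeg_single (a : ι) : monDeg d (single a 1) = d a := by
  rw [monDeg, Finset.sum_eq_single_of_mem a (Finset.mem_univ a)]
  · simp
  · exact fun b _ hb => by simp [Finsupp.single_eq_of_ne hb]

theorem sgn_monDeg (γ : Deg n) (α : ι →₀ ℕ) : sgn γ (monDeg d α) = ∏ b, sgn γ (d b) ^ α b := by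
  let sgnHom : Multiplicative (Deg n) →* ℝ :=
    { toFun := fun δ => sgn γ δ.toAdd
      map_one' := sgn_zero_right γ
      map_mul' := fun _ _ => sgn_add_right _ _ _ }
  have map_sum : sgnHom (∏ b, .ofAdd (d b) ^ α b) = ∏ b, sgnHom (.ofAdd (d b)) ^ α b := by
    simp only [map_prod, map_pow]
  exact map_sum

end Degree

variable [Fintype ι] [LinearOrder ι]

theorem cocycle_mul_self (α β : ι →₀ ℕ) : cocycle d α β * cocycle d α β = 1 := by
  simp only [cocycle, ← Finset.prod_mul_distrib]
  refine Finset.prod_eq_one fun a _ => Finset.prod_eq_one fun b _ => ?_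
  split_ifs
  · exact sgn_pow_mul_self _ _ _
  · exact one_mul 1

theorem cocycle_single_left (a : ι) (β : ι →₀ ℕ) :
    cocycle d (single a 1) β = ∏ b, if b < a then sgn (d a) (d b) ^ β b else 1 := by
  rw [cocycle, Finset.prod_eq_single_of_mem a (Finset.mem_univ a)]
  · simp
  · exact fun c _ hc => Finset.prod_eq_one fun b _ => by simp [Finsupp.single_eq_of_ne hc]

theorem cocycle_single_right (a : ι) (α : ι →₀ ℕ) :
    cocycle d α (single a 1) = ∏ b, if a < b then sgn (d a) (d b) ^ α b else 1 := by
  refine Finset.prod_congr rfl fun c _ => ?_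
  rw [Finset.prod_eq_single_of_mem a (Finset.mem_univ a)]
  · simp [sgn_comm]
  · exact fun b _ hb => by simp [Finsupp.single_eq_of_ne hb]

theorem cocycle_single_left_eq_one {a : ι} {β : ι →₀ ℕ} (h : ∀ b < a, β b = 0) :
    cocycle d (single a 1) β = 1 := by
  rw [cocycle_single_left]
  exact Finset.prod_eq_one fun b _ => by split_ifs with hb <;> simp [*]

theorem sgn_deg_monDeg (a : ι) (α : ι →₀ ℕ) : sgn (d a) (monDeg d α) =
    cocycle d (single a 1) α * sgn (d a) (d a) ^ α a * cocycle d α (single a 1) := by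
  have self_factor : sgn (d a) (d a) ^ α a = ∏ b, if b = a then sgn (d a) (d b) ^ α b else 1 := by
    simp
  rw [sgn_monDeg, self_factor, cocycle_single_left, cocycle_single_right,
    ← Finset.prod_mul_distrib, ← Finset.prod_mul_distrib]
  refine Finset.prod_congr rfl fun b _ => ?_
  rcases lt_trichotomy b a with h | h | h
  · simp [h, h.ne, h.not_gt]
  · simp [h]
  · simp [h, h.ne', h.not_gt]

variable {R : Type} [CommRing R] [Algebra ℝ R]

theorem coeff_sum {κ : Type*} (s : Finset κ) (f : κ → Series d R) (α : ι →₀ ℕ) :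
    coeff α (∑ i ∈ s, f i) = ∑ i ∈ s, coeff α (f i) :=
  map_sum (AddMonoidHom.mk' (coeff α) (coeff_add α)) f s

theorem coeff_mapCoeff {S : Type} [CommRing S] [Algebra ℝ S] (φ : R →ₗ[ℝ] S) (α : ι →₀ ℕ)
    (f : Series d R) : coeff α (mapCoeff φ f) = φ (coeff α f) := by
  by_cases h : Admissible d α
  · simp only [coeff_of_admissible h]
    rfl
  · rw [coeff_of_not_admissible h, coeff_of_not_admissible h, map_zero]

theorem coeff_formalDeriv (a : ι) (α : ι →₀ ℕ) (f : Series d R) :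
    coeff α (formalDeriv a f) =
      (cocycle d (single a 1) α * (α a + 1 : ℝ)) • coeff (α + single a 1) f := by
  by_cases h : Admissible d α
  · rw [coeff_of_admissible h, cocycle_single_left]
    rfl
  · rw [coeff_of_not_admissible h, coeff_of_not_admissible fun h' =>
      h (Admissible.of_add_left h'), smul_zero]

theorem var_mem (a : ι) : (var a : Series d R) ∈ homogeneous (d a) := by
  intro α hα
  rw [coeff_var, if_neg]
  rintro rfl
  exact hα (monDeg_single a)

theorem coeff_var_mul_of_eq_zero {a : ι} {α : ι →₀ ℕ} (ha : α a = 0) (f : Series d R) :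
    coeff α (var a * f) = 0 := by
  by_cases hα : Admissible d α
  · rw [coeff_mul hα]
    refine Finset.sum_eq_zero fun p hp => ?_
    rw [coeff_var, if_neg, zero_mul, smul_zero]
    intro h
    simpa [h, ha] using DFunLike.congr_fun (mem_antidiagonal.1 hp) a
  · exact coeff_of_not_admissible hα _

theorem coeff_add_single_var_mul {a : ι} {α : ι →₀ ℕ} (hα : Admissible d (α + single a 1))
    (f : Series d R) :
    coeff (α + single a 1) (var a * f) = cocycle d (single a 1) α • coeff α f := by
  rw [coeff_mul hα, Finset.sum_eq_single_of_mem (single a 1, α)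
    (mem_antidiagonal.2 (add_comm _ _))]
  · simp only [coeff_var, if_true, one_mul]
  · rintro ⟨μ, ν⟩ hp hne
    rw [coeff_var, if_neg, zero_mul, smul_zero]
    rintro rfl
    exact hne (Prod.ext rfl (add_right_injective _ ((mem_antidiagonal.1 hp).trans (add_comm _ _))))

/-- The series with a constant term only. -/
def const : R →ₗ[ℝ] Series d R where
  toFun r := fun α => if α.1 = 0 then r else 0
  map_add' _ _ := funext fun _ => ite_add_zero
  map_smul' t _ := funext fun _ => (smul_ite_zero _ t _).symm

theorem coeff_const (r : R) (α : ι →₀ ℕ) :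
    coeff α (const r : Series d R) = if α = 0 then r else 0 := by
  by_cases h : Admissible d α
  · rw [coeff_of_admissible h]
    rfl
  · rw [coeff_of_not_admissible h, if_neg]
    rintro rfl
    exact h admissible_zero

theorem const_one : const 1 = (1 : Series d R) := rfl

theorem const_algebraMap (t : ℝ) :
    const (algebraMap ℝ R t) = algebraMap ℝ (Series d R) t := by
  rw [Algebra.algebraMap_eq_smul_one, map_smul, const_one, Algebra.algebraMap_eq_smul_one]

theorem coeff_const_mul (r : R) (f : Series d R) (α : ι →₀ ℕ) :
    coeff α (const r * f) = r * coeff α f := by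
  by_cases h : Admissible d α
  · rw [coeff_mul h, Finset.sum_eq_single_of_mem (0, α) (mem_antidiagonal.2 (zero_add α))]
    · simp [coeff_const, cocycle_zero_left]
    · rintro ⟨μ, ν⟩ hp hne
      rw [coeff_const, if_neg, zero_mul, smul_zero]
      rintro rfl
      exact hne (Prod.ext rfl ((zero_add ν).symm.trans (mem_antidiagonal.1 hp)))
  · rw [coeff_of_not_admissible h, coeff_of_not_admissible h, mul_zero]

theorem const_mul (r s : R) : (const (r * s) : Series d R) = const r * const s := by
  ext α _
  rw [coeff_const_mul, coeff_const, coeff_const, mul_ite, mul_zero]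

theorem const_mem (r : R) : (const r : Series d R) ∈ homogeneous (0 : Deg n) := by
  intro α hα
  rw [coeff_const, if_neg]
  rintro rfl
  exact hα (by simp [monDeg])

open Classical in
/-- The terms of a series whose least variable is `ξ_a`, divided by `ξ_a`. -/
def divVar (a : ι) (f : Series d R) : Series d R := fun μ =>
  if ∀ b < a, μ.1 b = 0 then coeff (μ.1 + single a 1) f else 0

open Classical in
theorem coeff_var_mul_divVar (a : ι) (f : Series d R) {α : ι →₀ ℕ} (hα : Admissible d α) :
    coeff α (var a * divVar a f) = if α a ≠ 0 ∧ ∀ b < a, α b = 0 then coeff α f else 0 := by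
  by_cases ha : α a = 0
  · simp [coeff_var_mul_of_eq_zero ha, ha]
  obtain ⟨α, rfl⟩ := exists_eq_add_single ha
  have below_iff : (∀ b < a, (α + single a 1 : ι →₀ ℕ) b = 0) ↔ ∀ b < a, α b = 0 :=
    forall₂_congr fun b hb => by simp [Finsupp.single_eq_of_ne hb.ne]
  rw [coeff_add_single_var_mul hα, coeff_of_admissible (Admissible.of_add_left hα), divVar]
  by_cases below : ∀ b < a, α b = 0
  · rw [if_pos below, if_pos ⟨ha, below_iff.2 below⟩, cocycle_single_left_eq_one below, one_smul]
  · rw [if_neg below, if_neg fun h => below (below_iff.1 h.2), smul_zero]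

theorem eq_const_add_sum (f : Series d R) :
    f = const (coeff 0 f) + ∑ a, var a * divVar a f := by
  classical
  ext α hα
  simp only [coeff_add, coeff_const, coeff_sum, coeff_var_mul_divVar _ f hα]
  by_cases h0 : α = 0
  · simp [h0]
  obtain ⟨a, ha, a_min⟩ : ∃ a, α a ≠ 0 ∧ ∀ b < a, α b = 0 := by
    obtain ⟨a, ha, h⟩ := wellFounded_lt.has_min {a | α a ≠ 0} (Finsupp.ne_iff.1 h0)
    exact ⟨a, ha, fun b hb => not_not.1 fun hbα => h b hbα hb⟩
  rw [if_neg h0, zero_add, Finset.sum_eq_single_of_mem a (Finset.mem_univ a),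
    if_pos ⟨ha, a_min⟩]
  rintro b - hba
  refine if_neg fun ⟨hb, b_min⟩ => ?_
  rcases hba.lt_or_gt with h | h
  · exact hb (a_min b h)
  · exact ha (b_min a h)

-- `E` cannot lower the order in the variables, and `eq_const_add_sum` extracts one variable at
-- a time.
theorem end_eq_zero {E : Module.End ℝ (Series d R)}
    (hE : ∀ a, ∃ ε : ℝ, ∀ f, E (var a * f) = ε • (var a * E f)) (h0 : ∀ r, E (const r) = 0) :
    E = 0 := by
  suffices h : ∀ (N : ℕ) (α : ι →₀ ℕ), Admissible d α → α.degree < N →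
      ∀ f, coeff α (E f) = 0 by
    ext f α hα
    rw [h _ α hα (Nat.lt_succ_self _), LinearMap.zero_apply, coeff_zero]
  intro N
  induction N with
  | zero => exact fun α _ h => absurd h (Nat.not_lt_zero _)
  | succ N ih =>
    intro α hα hN f
    rw [eq_const_add_sum f, map_add, h0, zero_add, map_sum, coeff_sum]
    refine Finset.sum_eq_zero fun a _ => ?_
    obtain ⟨ε, hε⟩ := hE a
    rw [hε, coeff_smul]
    by_cases ha : α a = 0
    · rw [coeff_var_mul_of_eq_zero ha, smul_zero]
    · obtain ⟨α, rfl⟩ := exists_eq_add_single ha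
      rw [map_add, Finsupp.degree_single] at hN
      rw [coeff_add_single_var_mul hα, ih α (Admissible.of_add_left hα) (by omega), smul_zero,
        smul_zero]

theorem natCast_add_sgn_pow_mul {γ : Deg n} {l m : ℕ} (hl : IsOdd γ → l ≤ 1)
    (hm : IsOdd γ → m ≤ 1) : (l : ℝ) + sgn γ γ ^ l * m =
      open Classical in if IsOdd γ → l + m ≤ 1 then (l + m : ℝ) else 0 := by
  by_cases hγ : IsOdd γ
  · have := hl hγ
    have := hm hγ
    interval_cases l <;> interval_cases m <;> simp [hγ, sgn_self_of_isOdd]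
  · simp [hγ, sgn_self_of_not_isOdd]

theorem smul_coeff_add_single_mul (a : ι) {γ : ι →₀ ℕ} (hγ : Admissible d γ) (f g : Series d R) :
    (γ a + 1 : ℝ) • coeff (γ + single a 1) (f * g) =
      ∑ p ∈ antidiagonal (γ + single a 1 : ι →₀ ℕ),
        ((p.1 a : ℝ) + sgn (d a) (d a) ^ p.1 a * p.2 a) •
          cocycle d p.1 p.2 • (coeff p.1 f * coeff p.2 g) := by
  classical
  have term_eq : ∀ p ∈ antidiagonal (γ + single a 1 : ι →₀ ℕ),
      ((p.1 a : ℝ) + sgn (d a) (d a) ^ p.1 a * p.2 a) •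
        cocycle d p.1 p.2 • (coeff p.1 f * coeff p.2 g) =
      (if Admissible d (γ + single a 1) then (γ a + 1 : ℝ) else 0) •
        cocycle d p.1 p.2 • (coeff p.1 f * coeff p.2 g) := by
    intro p hp
    by_cases h₁ : Admissible d p.1; swap
    · simp [coeff_of_not_admissible h₁]
    by_cases h₂ : Admissible d p.2; swap
    · simp [coeff_of_not_admissible h₂]
    have apply_add : p.1 a + p.2 a = γ a + 1 := by
      simpa using DFunLike.congr_fun (mem_antidiagonal.1 hp) a
    have apply_add_real : (p.1 a + p.2 a : ℝ) = γ a + 1 := by exact_mod_cast apply_add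
    simp only [natCast_add_sgn_pow_mul (h₁ a) (h₂ a), apply_add, apply_add_real,
      admissible_add_single_iff hγ, add_le_iff_nonpos_left, nonpos_iff_eq_zero]
  rw [Finset.sum_congr rfl term_eq]
  split_ifs with h
  · rw [coeff_mul h, Finset.smul_sum]
  · simp [coeff_of_not_admissible h]

theorem coeff_formalDeriv_mul (a : ι) {γ : ι →₀ ℕ} (hγ : Admissible d γ) (f g : Series d R) :
    coeff γ (formalDeriv a f * g) = ∑ p ∈ antidiagonal (γ + single a 1 : ι →₀ ℕ),
      (cocycle d (single a 1) γ * p.1 a) • cocycle d p.1 p.2 • (coeff p.1 f * coeff p.2 g) := by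
  rw [← sum_antidiagonal_add_single_left a γ (fun μ ν => (cocycle d (single a 1) γ * μ a) •
    cocycle d μ ν • (coeff μ f * coeff ν g)) (fun μ ν h => by simp [h]), coeff_mul hγ]
  refine Finset.sum_congr rfl fun p hp => ?_
  rw [coeff_formalDeriv, smul_mul_assoc, smul_smul, smul_smul, ← mem_antidiagonal.1 hp,
    cocycle_add_left, cocycle_add_right]
  congr 1
  simp only [Finsupp.add_apply, Finsupp.single_eq_same, Nat.cast_add, Nat.cast_one]
  linear_combination (-(cocycle d p.1 p.2 * cocycle d (single a 1) p.1 * (p.1 a + 1 : ℝ))) *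
    cocycle_mul_self (d := d) (single a 1) p.2

theorem coeff_sgn_smul_mul_formalDeriv (a : ι) {φ : Deg n} {f : Series d R}
    (hf : f ∈ homogeneous φ) {γ : ι →₀ ℕ} (hγ : Admissible d γ) (g : Series d R) :
    coeff γ (sgn (d a) φ • (f * formalDeriv a g)) = ∑ p ∈ antidiagonal (γ + single a 1 : ι →₀ ℕ),
      (cocycle d (single a 1) γ * (sgn (d a) (d a) ^ p.1 a * p.2 a)) •
        cocycle d p.1 p.2 • (coeff p.1 f * coeff p.2 g) := by
  rw [← sum_antidiagonal_add_single_right a γ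
    (fun μ ν => (cocycle d (single a 1) γ * (sgn (d a) (d a) ^ μ a * ν a)) •
      cocycle d μ ν • (coeff μ f * coeff ν g)) (fun μ ν h => by simp [h]),
    coeff_smul, coeff_mul hγ, Finset.smul_sum]
  refine Finset.sum_congr rfl fun p hp => ?_
  by_cases hφ : monDeg d p.1 = φ
  · rw [coeff_formalDeriv, mul_smul_comm, smul_smul, smul_smul, smul_smul, ← hφ, sgn_deg_monDeg,
      ← mem_antidiagonal.1 hp, cocycle_add_right, cocycle_add_right]
    congr 1
    simp only [Finsupp.add_apply, Finsupp.single_eq_same, Nat.cast_add, Nat.cast_one]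
    ring
  · simp [hf p.1 hφ]

theorem formalDeriv_leibniz (a : ι) {φ : Deg n} {f : Series d R} (hf : f ∈ homogeneous φ)
    (g : Series d R) :
    formalDeriv a (f * g) = formalDeriv a f * g + sgn (d a) φ • (f * formalDeriv a g) := by
  ext γ hγ
  rw [coeff_formalDeriv, coeff_add, coeff_formalDeriv_mul a hγ,
    coeff_sgn_smul_mul_formalDeriv a hf hγ, mul_smul, smul_coeff_add_single_mul a hγ,
    Finset.smul_sum, ← Finset.sum_add_distrib]
  refine Finset.sum_congr rfl fun p _ => ?_
  rw [← add_smul, smul_smul, mul_add]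

theorem formalDeriv_mem (a : ι) {δ : Deg n} {f : Series d R} (hf : f ∈ homogeneous δ) :
    formalDeriv a f ∈ homogeneous (δ + d a) := by
  intro α hα
  rw [coeff_formalDeriv, hf, smul_zero]
  intro h
  rw [monDeg_add, monDeg_single] at h
  exact hα (by rw [← h, add_assoc, ZModModule.add_self, add_zero])

theorem formalDeriv_const (a : ι) (r : R) : formalDeriv a (const r : Series d R) = 0 := by
  ext α _
  rw [coeff_formalDeriv, coeff_const, if_neg, smul_zero, coeff_zero]
  intro h
  simpa using DFunLike.congr_fun h a

theorem formalDeriv_var (a b : ι) :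
    formalDeriv a (var b : Series d R) = if a = b then 1 else 0 := by
  ext α _
  rw [coeff_formalDeriv, coeff_var]
  rcases eq_or_ne a b with rfl | hab
  · by_cases h0 : α = 0 <;> simp [h0, coeff_one, cocycle_zero_right]
  · rw [if_neg, if_neg hab, smul_zero, coeff_zero]
    intro h
    simpa [Finsupp.single_eq_of_ne hab] using DFunLike.congr_fun h a

section MapCoeff

variable {S : Type} [CommRing S] [Algebra ℝ S]

theorem mapCoeff_mem (φ : R →ₗ[ℝ] S) {δ : Deg n} {f : Series d R} (hf : f ∈ homogeneous δ) :
    mapCoeff φ f ∈ homogeneous δ := by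
  intro α hα
  rw [coeff_mapCoeff, hf α hα, map_zero]

theorem mapCoeff_const (φ : R →ₗ[ℝ] S) (r : R) :
    mapCoeff φ (const r : Series d R) = const (φ r) := by
  ext α _
  rw [coeff_mapCoeff, coeff_const, coeff_const, apply_ite φ, map_zero]

theorem mapCoeff_var {φ : R →ₗ[ℝ] S} (h : φ 1 = 0) (a : ι) :
    mapCoeff φ (var a : Series d R) = 0 := by
  ext α _
  rw [coeff_mapCoeff, coeff_var, coeff_zero, apply_ite φ, h, map_zero, ite_self]

theorem mapCoeff_leibniz {φ : R →ₗ[ℝ] R} (h : ∀ r s, φ (r * s) = φ r * s + r * φ s)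
    (f g : Series d R) : mapCoeff φ (f * g) = mapCoeff φ f * g + f * mapCoeff φ g := by
  ext α hα
  simp only [coeff_mapCoeff, coeff_mul hα, coeff_add, map_sum, map_smul, h, smul_add,
    Finset.sum_add_distrib]

theorem mapCoeff_formalDeriv (φ : R →ₗ[ℝ] S) (a : ι) (f : Series d R) :
    mapCoeff φ (formalDeriv a f) = formalDeriv a (mapCoeff φ f) := by
  ext α _
  simp only [coeff_mapCoeff, coeff_formalDeriv, map_smul]

end MapCoeff

end Series

/-! ### Smooth functions and the coordinate domain -/

section Calculus

open MeasureTheory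

variable {E F : Type u} [NormedAddCommGroup E] [NormedSpace ℝ E] [FiniteDimensional ℝ E]
  [NormedAddCommGroup F] [NormedSpace ℝ F]

theorem hasFDerivAt_integral_of_contDiff {f : E × ℝ → F} (hf : ContDiff ℝ ∞ f) (a b : ℝ)
    (x₀ : E) :
    HasFDerivAt (fun x => ∫ t in a..b, f (x, t))
      (∫ t in a..b, (fderiv ℝ f (x₀, t)).comp (ContinuousLinearMap.inl ℝ E ℝ)) x₀ := by
  have continuous_deriv :
      Continuous fun z : E × ℝ => (fderiv ℝ f z).comp (ContinuousLinearMap.inl ℝ E ℝ) :=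
    (hf.continuous_fderiv (by simp)).clm_comp continuous_const
  obtain ⟨B, hB⟩ := ((isCompact_closedBall x₀ 1).prod (isCompact_uIcc (a := a) (b := b))
    ).exists_bound_of_continuousOn continuous_deriv.continuousOn
  have continuous_f := hf.continuous
  refine (intervalIntegral.hasFDerivAt_integral_of_dominated_of_fderiv_le (μ := volume)
    (F := fun x t => f (x, t))
    (F' := fun x t => (fderiv ℝ f (x, t)).comp (ContinuousLinearMap.inl ℝ E ℝ))
    (bound := fun _ => B) (Metric.closedBall_mem_nhds x₀ one_pos) ?_ ?_ ?_ ?_ ?_ ?_)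
  · exact Filter.Eventually.of_forall fun x =>
      (by fun_prop : Continuous fun t => f (x, t)).aestronglyMeasurable
  · exact (by fun_prop : Continuous fun t => f (x₀, t)).intervalIntegrable _ _
  · exact (continuous_deriv.comp
      (by fun_prop : Continuous fun t : ℝ => (x₀, t))).aestronglyMeasurable
  · exact Filter.Eventually.of_forall fun t ht x hx =>
      hB (x, t) ⟨hx, Set.uIoc_subset_uIcc ht⟩
  · exact intervalIntegrable_const
  · exact Filter.Eventually.of_forall fun t _ x _ =>
      HasFDerivAt.comp x (hf.differentiable (by simp) (x, t)).hasFDerivAt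
        (hasFDerivAt_prodMk_left x t)

theorem contDiff_integral {f : E × ℝ → F} (hf : ContDiff ℝ ∞ f) (a b : ℝ) :
    ContDiff ℝ ∞ fun x => ∫ t in a..b, f (x, t) := by
  rw [contDiff_infty]
  intro m
  induction m generalizing F with
  | zero =>
    rw [Nat.cast_zero, contDiff_zero]
    exact intervalIntegral.continuous_parametric_intervalIntegral_of_continuous'
      (f := fun x t => f (x, t)) hf.continuous a b
  | succ m ih =>
    rw [Nat.cast_add, Nat.cast_one, contDiff_succ_iff_hasFDerivAt]
    exact ⟨_, ih ((hf.fderiv_right (by simp)).clm_comp contDiff_const),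
      hasFDerivAt_integral_of_contDiff hf a b⟩

/-- Hadamard's lemma. -/
theorem exists_contDiff_apply_sub [CompleteSpace F] {f : E → F} (hf : ContDiff ℝ ∞ f) (x₀ : E) :
    ∃ L : E → E →L[ℝ] F, ContDiff ℝ ∞ L ∧ ∀ x, f x = f x₀ + L x (x - x₀) := by
  have contDiff_fderiv : ContDiff ℝ ∞ (fderiv ℝ f) := hf.fderiv_right (by simp)
  have contDiff_segment : ContDiff ℝ ∞ fun z : E × ℝ => fderiv ℝ f (x₀ + z.2 • (z.1 - x₀)) :=
    contDiff_fderiv.comp (by fun_prop)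
  refine ⟨fun x => ∫ t in (0 : ℝ)..1, fderiv ℝ f (x₀ + t • (x - x₀)),
    contDiff_integral contDiff_segment 0 1, fun x => ?_⟩
  have continuous_segment : Continuous fun t : ℝ => fderiv ℝ f (x₀ + t • (x - x₀)) :=
    contDiff_fderiv.continuous.comp (by fun_prop)
  have hasDerivAt_segment (t : ℝ) : HasDerivAt (fun t : ℝ => f (x₀ + t • (x - x₀)))
      (fderiv ℝ f (x₀ + t • (x - x₀)) (x - x₀)) t :=
    (hf.differentiable (by simp) _).hasFDerivAt.comp_hasDerivAt t
      (by simpa using ((hasDerivAt_id t).smul_const (x - x₀)).const_add x₀)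
  rw [ContinuousLinearMap.intervalIntegral_apply (continuous_segment.intervalIntegrable _ _),
    intervalIntegral.integral_eq_sub_of_hasDerivAt (fun t _ => hasDerivAt_segment t)
      ((continuous_segment.clm_apply continuous_const).intervalIntegrable _ _)]
  simp

end Calculus

section Smooth

variable {p : ℕ} {V : Opens (Base p)}

/-- The smooth function on an open subset given by a function that is smooth at its points. -/
def smoothOf (V : Opens (Base p)) (f : Base p → ℝ) (hf : ∀ x ∈ V, ContDiffAt ℝ ∞ f x) : Smooth V :=
  ⟨fun x => f x, fun x => contMDiffAt_subtype_iff.mpr (hf x x.2).contMDiffAt⟩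

theorem smoothOf_apply (f : Base p → ℝ) (hf : ∀ x ∈ V, ContDiffAt ℝ ∞ f x) (x : V) :
    smoothOf V f hf x = f x := rfl

theorem extendZero_eventuallyEq {f : Base p → ℝ} {g : V → ℝ} (h : ∀ x : V, g x = f x) (x : V) :
    extendZero g =ᶠ[nhds (x : Base p)] f := by
  filter_upwards [V.isOpen.mem_nhds x.2] with y hy
  rw [← h ⟨y, hy⟩]
  exact extendZero_coe g ⟨y, hy⟩

theorem smoothDeriv_apply (i : Fin p) (f : Smooth V) (x : V) :
    smoothDeriv i f x = fderiv ℝ (extendZero f) (x : Base p) (EuclideanSpace.single i 1) := rfl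

theorem smoothDeriv_smoothOf (i : Fin p) (f : Base p → ℝ) (hf : ∀ x ∈ V, ContDiffAt ℝ ∞ f x)
    (x : V) : smoothDeriv i (smoothOf V f hf) x =
      fderiv ℝ f (x : Base p) (EuclideanSpace.single i 1) := by
  rw [smoothDeriv_apply, (extendZero_eventuallyEq (smoothOf_apply f hf) x).fderiv_eq]

theorem extendZero_mul (f g : V → ℝ) :
    extendZero (f * g) = extendZero f * extendZero g := by
  funext y
  by_cases hy : y ∈ V <;> simp [extendZero, hy]

theorem smoothDeriv_mul (i : Fin p) (f g : Smooth V) :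
    smoothDeriv i (f * g) = smoothDeriv i f * g + f * smoothDeriv i g := by
  ext x
  simp only [ContMDiffMap.coe_add, ContMDiffMap.coe_mul, Pi.add_apply, Pi.mul_apply,
    smoothDeriv_apply, extendZero_mul]
  rw [fderiv_mul ((contDiffAt_extendZero f x).differentiableAt (by simp))
    ((contDiffAt_extendZero g x).differentiableAt (by simp))]
  simp only [add_apply, smul_apply, extendZero_coe, smul_eq_mul]
  ring

theorem smoothDeriv_one (i : Fin p) : smoothDeriv i (1 : Smooth V) = 0 := by
  simpa using smoothDeriv_mul i (1 : Smooth V) 1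

theorem smoothRes_smoothDeriv {W : Opens (Base p)} (h : W ≤ V) (i : Fin p) (f : Smooth V) :
    smoothRes h (smoothDeriv i f) = smoothDeriv i (smoothRes h f) := by
  ext x
  rw [smoothDeriv_apply, (extendZero_eventuallyEq (f := extendZero f) (fun y => ?_) x).fderiv_eq]
  · rfl
  · exact (extendZero_coe f ⟨y, h y.2⟩).symm

/-- The coordinate function `x^i`. -/
def smoothCoord (V : Opens (Base p)) (i : Fin p) : Smooth V :=
  smoothOf V (fun x => x i) fun x _ => by fun_prop

theorem smoothDeriv_smoothCoord (i j : Fin p) :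
    smoothDeriv i (smoothCoord V j) = if i = j then 1 else 0 := by
  ext x
  have fderiv_coord : fderiv ℝ (fun x : Base p => x j) x = EuclideanSpace.proj j :=
    (EuclideanSpace.proj j : Base p →L[ℝ] ℝ).fderiv
  rw [smoothCoord, smoothDeriv_smoothOf, fderiv_coord]
  rcases eq_or_ne i j with rfl | hij
  · simp
  · simp [hij, hij.symm]

theorem clm_apply_eq_sum (L : Base p →L[ℝ] ℝ) (v : Base p) :
    L v = ∑ i, v i * L (EuclideanSpace.single i 1) := by
  conv_lhs => rw [← (EuclideanSpace.basisFun (Fin p) ℝ).sum_repr v]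
  simp [map_sum]

-- With a cut-off function `χ` at `x₀`, write `f - f x₀ = χ (f - f x₀) - (χ - 1) (f - f x₀)` and
-- apply Hadamard's lemma to the globally defined functions `χ (f - f x₀)` and `χ`.
theorem exists_eq_add_sum_coord_mul (f : Smooth V) (x₀ : V) :
    ∃ g : Fin p → Smooth V, f = algebraMap ℝ _ (f x₀) +
      ∑ i, (smoothCoord V i - algebraMap ℝ _ ((x₀ : Base p) i)) * g i := by
  obtain ⟨χ, tsupport_χ, -, contDiff_χ, -, χ_x₀⟩ :=
    exists_contDiff_tsupport_subset (n := ⊤) (V.isOpen.mem_nhds x₀.2)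
  have contDiff_cutoff : ContDiff ℝ ∞ fun x => χ x * (extendZero f x - f x₀) :=
    (contMDiff_of_tsupport fun x hx => (contDiff_χ.contDiffAt.mul
      ((contDiffAt_extendZero f ⟨x, tsupport_χ (tsupport_mul_subset_left hx)⟩).sub
        contDiffAt_const)).contMDiffAt).contDiff
  obtain ⟨L, contDiff_L, hL⟩ := exists_contDiff_apply_sub contDiff_cutoff (x₀ : Base p)
  obtain ⟨M, contDiff_M, hM⟩ := exists_contDiff_apply_sub contDiff_χ (x₀ : Base p)
  refine ⟨fun i =>
    smoothOf V (fun x => L x (EuclideanSpace.single i 1))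
      (fun x _ => (contDiff_L.clm_apply contDiff_const).contDiffAt) -
    smoothOf V (fun x => M x (EuclideanSpace.single i 1))
      (fun x _ => (contDiff_M.clm_apply contDiff_const).contDiffAt) *
        (f - algebraMap ℝ _ (f x₀)), ?_⟩
  ext x
  have eval_sum (g : Fin p → Smooth V) : (∑ i, g i) x = ∑ i, g i x :=
    map_sum (ContMDiffMap.evalRingHom x) g Finset.univ
  rw [ContMDiffMap.coe_add, Pi.add_apply, eval_sum]
  change f x = f x₀ + ∑ i, ((x : Base p) - (x₀ : Base p)) i * (L x (EuclideanSpace.single i 1) -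
    M x (EuclideanSpace.single i 1) * (f x - f x₀))
  simp only [mul_sub, Finset.sum_sub_distrib, ← mul_assoc, ← Finset.sum_mul, ← clm_apply_eq_sum]
  have hLx := hL x
  have hMx := hM x
  simp only [extendZero_coe, sub_self, mul_zero, zero_add] at hLx
  rw [χ_x₀] at hMx
  linear_combination hLx - (f x - f x₀) * hMx

end Smooth

section Domain

variable {n p : ℕ} {q : {γ : Deg n // γ ≠ 0} → ℕ} {V : Opens (Base p)}

theorem domain_end_eq_zero {E : Module.End ℝ (DomainSections q V)}
    (hvar : ∀ a, ∃ ε : ℝ, ∀ f, E (Series.var a * f) = ε • (Series.var a * E f))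
    (hcoord : ∀ i f, E (Series.const (smoothCoord V i) * f) =
      Series.const (smoothCoord V i) * E f) (h1 : E 1 = 0) : E = 0 := by
  have map_coord_sub_mul (i : Fin p) (t : ℝ) (f : DomainSections q V) :
      E (Series.const (smoothCoord V i - algebraMap ℝ _ t) * f) =
        Series.const (smoothCoord V i - algebraMap ℝ _ t) * E f := by
    rw [map_sub, Series.const_algebraMap, sub_mul, sub_mul, map_sub, hcoord, ← Algebra.smul_def,
      ← Algebra.smul_def, map_smul]
  have map_algebraMap (t : ℝ) : E (algebraMap ℝ _ t) = 0 := by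
    rw [Algebra.algebraMap_eq_smul_one, map_smul, h1, smul_zero]
  refine Series.end_eq_zero hvar fun r => ?_
  ext α _ x₀
  obtain ⟨g, hg⟩ := exists_eq_add_sum_coord_mul r x₀
  rw [hg, map_add, map_sum, map_add, map_sum, Series.const_algebraMap, map_algebraMap, zero_add,
    Series.coeff_sum, Series.coeff_zero]
  refine (map_sum (ContMDiffMap.evalRingHom x₀) _ _).trans (Finset.sum_eq_zero fun i _ => ?_)
  rw [Series.const_mul, map_coord_sub_mul, Series.coeff_const_mul, map_mul]
  exact mul_eq_zero_of_left (sub_self _) _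

end Domain

/-! ### Locality, restriction and gluing -/

section Locality

variable {n : ℕ} {A : Type*} [Ring A] [Algebra ℝ A] {𝒜 : Deg n → Submodule ℝ A}
  [GradedAlgebra 𝒜]

theorem bracketMul_of_mem_zero {σ : A} (hσ : σ ∈ 𝒜 0) (D : Module.End ℝ A) :
    bracketMul 𝒜 σ D = D * LinearMap.mulLeft ℝ σ - LinearMap.mulLeft ℝ σ * D := by
  change gradedCommutator 𝒜 D (LinearMap.mulLeft ℝ σ) = _
  simp only [gradedCommutator_mulLeft 𝒜 hσ, sgn_zero_right, one_smul, Finset.sum_sub_distrib,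
    ← Finset.sum_mul, ← Finset.mul_sum, sum_endComponent]

theorem dvd_apply_pow_mul {σ : A} (hσ : σ ∈ 𝒜 0) {k : ℕ} {D : Module.End ℝ A}
    (hD : D ∈ orderLT 𝒜 k) (f : A) : σ ∣ D (σ ^ k * f) := by
  induction k generalizing D with
  | zero => simp [(mem_orderLT_zero 𝒜).1 hD]
  | succ k ih =>
    have dvd_bracket := ih ((mem_orderLT_succ 𝒜).1 hD σ)
    rw [bracketMul_of_mem_zero hσ, LinearMap.sub_apply, Module.End.mul_apply,
      Module.End.mul_apply, LinearMap.mulLeft_apply, LinearMap.mulLeft_apply, ← mul_assoc,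
      ← pow_succ'] at dvd_bracket
    exact (dvd_sub_left (dvd_mul_right σ _)).1 dvd_bracket

end Locality

namespace RingedSpace

section Restriction

variable {n : ℕ} (X : RingedSpace.{u} n)

theorem res_self (U : Opens X.carrier) (f : X.Sec U) : X.res (le_refl U) f = f :=
  ConcreteCategory.congr_hom (X.presheaf.map_id (op U)) f

theorem res_res {U V W : Opens X.carrier} (h : V ≤ U) (h' : W ≤ V) (f : X.Sec U) :
    X.res h' (X.res h f) = X.res (h'.trans h) f :=
  (ConcreteCategory.congr_hom (X.presheaf.map_comp (homOfLE h).op (homOfLE h').op) f).symm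

theorem eq_of_res_eq {U : Opens X.carrier} {s t : X.Sec U}
    (h : ∀ x ∈ U, ∃ (V : Opens X.carrier) (hV : V ≤ U), x ∈ V ∧ X.res hV s = X.res hV t) :
    s = t := by
  choose V hV hx hst using h
  exact X.sheaf.eq_of_locally_eq' (fun x : U => V x x.2) U (fun x => homOfLE (hV x x.2))
    (fun x hxU => Opens.mem_iSup.2 ⟨⟨x, hxU⟩, hx x hxU⟩) s t fun x => hst x x.2

theorem exists_glue {U : Opens X.carrier} {ι : Type*} (V : ι → Opens X.carrier)
    (hV : ∀ i, V i ≤ U) (hcov : ∀ x ∈ U, ∃ i, x ∈ V i) (s : ∀ i, X.Sec (V i))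
    (hs : ∀ i j, X.res (inf_le_left : V i ⊓ V j ≤ V i) (s i) =
      X.res (inf_le_right : V i ⊓ V j ≤ V j) (s j)) :
    ∃ f : X.Sec U, ∀ i, X.res (hV i) f = s i := by
  obtain ⟨f, hf, -⟩ := X.sheaf.existsUnique_gluing' V U (fun i => homOfLE (hV i))
    (fun x hx => Opens.mem_iSup.2 (hcov x hx)) s hs
  exact ⟨f, hf⟩

theorem exists_extension_by_zero {V C : Opens X.carrier} (hVC : V ⊔ C = ⊤) (s : X.Sec V)
    (hs : X.res (inf_le_left : V ⊓ C ≤ V) s = 0) :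
    ∃ F : X.Sec ⊤, X.res le_top F = s ∧ X.res (le_top : C ≤ ⊤) F = 0 := by
  let cover : Bool → Opens X.carrier := fun b => if b then V else C
  let sections : ∀ b, X.Sec (cover b) := fun
    | true => s
    | false => 0
  obtain ⟨F, hF⟩ := X.exists_glue (U := ⊤) cover (fun _ => le_top)
    (fun x hx => (hVC.ge hx).elim (fun h => ⟨true, h⟩) fun h => ⟨false, h⟩) sections (by
      rintro (_ | _) (_ | _)
      · rfl
      · change X.res _ (0 : X.Sec C) = X.res _ s
        rw [map_zero, ← X.res_res inf_le_left (le_inf inf_le_right inf_le_left), hs, map_zero]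
      · exact hs.trans (map_zero _).symm
      · rfl)
  exact ⟨F, hF true, hF false⟩

theorem mul_eq_zero_of_res_eq_zero {U V C : Opens X.carrier} (hV : V ≤ U) (hVC : U ≤ V ⊔ C)
    {f g : X.Sec U} (hf : X.res (inf_le_left : U ⊓ C ≤ U) f = 0) (hg : X.res hV g = 0) :
    f * g = 0 := by
  refine X.eq_of_res_eq fun x hx => ?_
  rcases hVC hx with hxV | hxC
  · exact ⟨V, hV, hxV, by rw [map_mul, hg, mul_zero, map_zero]⟩
  · exact ⟨U ⊓ C, inf_le_left, ⟨hx, hxC⟩, by rw [map_mul, hf, zero_mul, map_zero]⟩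

theorem res_mem_part {U V : Opens X.carrier} (h : V ≤ U) {γ : Deg n} {f : X.Sec U}
    (hf : f ∈ X.part U γ) : X.res h f ∈ X.part V γ :=
  X.map_mem_part h γ f hf

theorem proj_res {U V : Opens X.carrier} (h : V ≤ U) (γ : Deg n) (f : X.Sec U) :
    GradedAlgebra.proj (X.part V) γ (X.res h f) =
      X.res h (GradedAlgebra.proj (X.part U) γ f) := by
  induction f using DirectSum.Decomposition.inductionOn (X.part U) with
  | zero => simp
  | homogeneous f =>
    rw [proj_of_mem _ f.2, proj_of_mem _ (X.res_mem_part h f.2)]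
    split_ifs <;> simp
  | add f g hf hg => simp only [map_add, hf, hg]

theorem mem_part_of_locally {U : Opens X.carrier} {f : X.Sec U} {γ : Deg n}
    (h : ∀ x ∈ U, ∃ (V : Opens X.carrier) (hV : V ≤ U), x ∈ V ∧ X.res hV f ∈ X.part V γ) :
    f ∈ X.part U γ := by
  have eq_proj : f = GradedAlgebra.proj (X.part U) γ f := by
    refine X.eq_of_res_eq fun x hx => ?_
    obtain ⟨V, hV, hxV, hf⟩ := h x hx
    exact ⟨V, hV, hxV, by rw [← proj_res, proj_of_mem _ hf, if_pos rfl]⟩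
  rw [eq_proj]
  exact proj_mem _ γ f

end Restriction

section Restricts

variable {n : ℕ} {X : RingedSpace.{u} n}

/-- The operator `D'` over `V` restricts the operator `D` over `U`. -/
def Restricts {U V : Opens X.carrier} (h : V ≤ U) (D : Module.End ℝ (X.Sec U))
    (D' : Module.End ℝ (X.Sec V)) : Prop :=
  ∀ g, D' (X.res h g) = X.res h (D g)

namespace Restricts

variable {U V W : Opens X.carrier} {h : V ≤ U} {D E : Module.End ℝ (X.Sec U)}
  {D' E' : Module.End ℝ (X.Sec V)}

theorem trans {h' : W ≤ V} {D'' : Module.End ℝ (X.Sec W)} (hD : Restricts h D D')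
    (hD' : Restricts h' D' D'') : Restricts (h'.trans h) D D'' := fun g => by
  rw [← res_res X h h', hD', hD, res_res]

theorem mulLeft (h : V ≤ U) (f : X.Sec U) :
    Restricts h (LinearMap.mulLeft ℝ f) (LinearMap.mulLeft ℝ (X.res h f)) := fun g => by
  simp

theorem smul (hD : Restricts h D D') (f : X.Sec U) : Restricts h (f • D) (X.res h f • D') :=
  fun g => by simp [hD g]

theorem add (hD : Restricts h D D') (hE : Restricts h E E') : Restricts h (D + E) (D' + E') :=
  fun g => by simp [hD g, hE g]

theorem endComponent (hD : Restricts h D D') (γ : Deg n) :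
    Restricts h (endComponent (X.part U) γ D) (endComponent (X.part V) γ D') := fun g => by
  simp only [endComponent_apply, proj_res, hD _, map_sum]

theorem bracketMul (hD : Restricts h D D') (f : X.Sec U) :
    Restricts h (bracketMul (X.part U) f D) (bracketMul (X.part V) (X.res h f) D') := by
  intro g
  change gradedCommutator (X.part V) D' (LinearMap.mulLeft ℝ (X.res h f)) _ =
    X.res h (gradedCommutator (X.part U) D (LinearMap.mulLeft ℝ f) g)
  simp only [gradedCommutator, LinearMap.sum_apply, LinearMap.sub_apply, LinearMap.smul_apply,
    Module.End.mul_apply, map_sum, map_sub, map_smul, (hD.endComponent _) _,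
    ((mulLeft h f).endComponent _) _]

end Restricts

theorem mem_orderLT_of_locally {U : Opens X.carrier} {k : ℕ} {D : Module.End ℝ (X.Sec U)}
    (h : ∀ x ∈ U, ∃ (V : Opens X.carrier) (hV : V ≤ U), x ∈ V ∧
      ∃ D' : Module.End ℝ (X.Sec V), Restricts hV D D' ∧ D' ∈ orderLT (X.part V) k) :
    D ∈ orderLT (X.part U) k := by
  induction k generalizing D with
  | zero =>
    refine (mem_orderLT_zero _).2 (LinearMap.ext fun g => X.eq_of_res_eq fun x hx => ?_)
    obtain ⟨V, hV, hxV, D', hD', hD'_zero⟩ := h x hx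
    exact ⟨V, hV, hxV, by simp [← hD' g, (mem_orderLT_zero _).1 hD'_zero]⟩
  | succ k ih =>
    refine (mem_orderLT_succ _).2 fun f => ih fun x hx => ?_
    obtain ⟨V, hV, hxV, D', hD', hD'_mem⟩ := h x hx
    exact ⟨V, hV, hxV, _, hD'.bracketMul f, (mem_orderLT_succ _).1 hD'_mem _⟩

end Restricts

section Bumps

variable {n : ℕ} {X : RingedSpace.{u} n}

variable (X) in
/-- Around every point of an open subset `U`, the constant `1` extends to a global section of
degree zero with support in `U`. That the support lies in `U` is expressed by the vanishing on an
open subset `C` that covers the space together with `U`. -/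
def HasBumps : Prop :=
  ∀ (U : Opens X.carrier), ∀ x ∈ U, ∃ ρ ∈ X.part ⊤ 0, ∃ W C : Opens X.carrier, x ∈ W ∧ W ≤ U ∧
    U ⊔ C = ⊤ ∧ X.res le_top ρ = (1 : X.Sec W) ∧ X.res le_top ρ = (0 : X.Sec C)

theorem exists_extension (hX : X.HasBumps) {U V : Opens X.carrier} (h : V ≤ U) {x : X.carrier}
    (hx : x ∈ V) : ∃ (W : Opens X.carrier) (hW : W ≤ V), x ∈ W ∧
      ∀ f : X.Sec V, ∃ F : X.Sec U, X.res (hW.trans h) F = X.res hW f := by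
  obtain ⟨ρ, -, W, C, hxW, hW, hC, ρ_W, ρ_C⟩ := hX V x hx
  refine ⟨W, hW, hxW, fun f => ?_⟩
  obtain ⟨F, F_V, -⟩ := X.exists_extension_by_zero hC (X.res le_top ρ * f) (by
    rw [map_mul, res_res, ← X.res_res le_top inf_le_right, ρ_C, map_zero, zero_mul])
  refine ⟨X.res le_top F, ?_⟩
  rw [res_res, ← X.res_res le_top hW, F_V, map_mul, res_res, ρ_W, one_mul]

-- With a bump function `ρ` at a point of `V`, supported in `V`, the section `σ = 1 - ρ` satisfies
-- `σ f = f`, so that `D f = D (σ ^ k f)` is a multiple of `σ` and vanishes near this point.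
theorem res_apply_eq_zero (hX : X.HasBumps) {U V : Opens X.carrier} (h : V ≤ U) {k : ℕ}
    {D : Module.End ℝ (X.Sec U)} (hD : D ∈ orderLT (X.part U) k) {f : X.Sec U}
    (hf : X.res h f = 0) : X.res h (D f) = 0 := by
  refine X.eq_of_res_eq fun x hx => ?_
  obtain ⟨ρ, hρ, W, C, hxW, hW, hC, ρ_W, ρ_C⟩ := hX V x hx
  refine ⟨W, hW, hxW, ?_⟩
  have ρ_mul : X.res le_top ρ * f = 0 :=
    X.mul_eq_zero_of_res_eq_zero h (hC.ge.trans' le_top)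
      (by rw [res_res, ← X.res_res le_top inf_le_right, ρ_C, map_zero]) hf
  have σ_pow_mul (m : ℕ) : (1 - X.res le_top ρ) ^ m * f = f := by
    induction m with
    | zero => simp
    | succ m ih => rw [pow_succ, mul_assoc, sub_mul, one_mul, ρ_mul, sub_zero, ih]
  obtain ⟨g, hg⟩ := dvd_apply_pow_mul
    (sub_mem (SetLike.one_mem_graded (X.part U)) (X.res_mem_part _ hρ)) hD f
  rw [σ_pow_mul] at hg
  rw [hg, res_res, map_zero, map_mul, map_sub, map_one, res_res, ρ_W, sub_self, zero_mul]

theorem res_apply_congr (hX : X.HasBumps) {U V : Opens X.carrier} (h : V ≤ U) {k : ℕ}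
    {D : Module.End ℝ (X.Sec U)} (hD : D ∈ orderLT (X.part U) k) {f g : X.Sec U}
    (hfg : X.res h f = X.res h g) : X.res h (D f) = X.res h (D g) := by
  rw [← sub_eq_zero, ← map_sub, ← map_sub]
  exact res_apply_eq_zero hX h hD (by rw [map_sub, hfg, sub_self])

theorem Restricts.unique (hX : X.HasBumps) {U V : Opens X.carrier} {h : V ≤ U} {k l : ℕ}
    {D : Module.End ℝ (X.Sec U)} {D' D'' : Module.End ℝ (X.Sec V)} (h' : Restricts h D D')
    (h'' : Restricts h D D'') (hD' : D' ∈ orderLT (X.part V) k)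
    (hD'' : D'' ∈ orderLT (X.part V) l) : D' = D'' := by
  refine LinearMap.ext fun g => X.eq_of_res_eq fun x hx => ?_
  obtain ⟨W, hW, hxW, extend⟩ := exists_extension hX h hx
  obtain ⟨G, hG⟩ := extend g
  have hgG : X.res hW g = X.res hW (X.res h G) := by rw [res_res, hG]
  exact ⟨W, hW, hxW, by
    rw [res_apply_congr hX hW hD' hgG, res_apply_congr hX hW hD'' hgG, h' G, h'' G]⟩

theorem Restricts.mem_endHomogeneous (hX : X.HasBumps) {U V : Opens X.carrier} {h : V ≤ U} {k : ℕ}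
    {D : Module.End ℝ (X.Sec U)} {D' : Module.End ℝ (X.Sec V)} (hr : Restricts h D D')
    (hD' : D' ∈ orderLT (X.part V) k) {γ : Deg n} (hD : D ∈ endHomogeneous (X.part U) γ) :
    D' ∈ endHomogeneous (X.part V) γ := by
  have restricts_component : Restricts h D (Z2n.endComponent (X.part V) γ D') := by
    have := hr.endComponent γ
    rwa [endComponent_of_mem _ hD, if_pos rfl] at this
  rw [hr.unique hX restricts_component hD' (endComponent_mem_orderLT hD' γ)]
  exact endComponent_mem _ γ D'

end Bumps

section LocalEnd

variable {n : ℕ} {X : RingedSpace.{u} n}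

/-- An `ℝ`-linear endomorphism of the restriction of the structure sheaf to `U`. -/
structure LocalEnd (U : Opens X.carrier) where
  /-- The operator over an open subset of `U`. -/
  op : ∀ V, V ≤ U → Module.End ℝ (X.Sec V)
  restricts : ∀ {V W} (h : V ≤ U) (h' : W ≤ V), Restricts h' (op V h) (op W (h'.trans h))

namespace LocalEnd

variable {U : Opens X.carrier} {k : ℕ}

/-- The graded commutator of an endomorphism of the structure sheaf with the multiplication by a
section. -/
def bracketMul (Φ : LocalEnd U) (F : X.Sec U) : LocalEnd U where
  op V hV := Z2n.bracketMul (X.part V) (X.res hV F) (Φ.op V hV)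
  restricts hV hW := by
    rw [← X.res_res hV hW]
    exact (Φ.restricts hV hW).bracketMul _

theorem op_mem_orderLT (hX : X.HasBumps) (Φ : LocalEnd U)
    (hΦ : Φ.op U le_rfl ∈ orderLT (X.part U) k) (V : Opens X.carrier) (hV : V ≤ U) :
    Φ.op V hV ∈ orderLT (X.part V) k := by
  induction k generalizing Φ V with
  | zero =>
    refine (mem_orderLT_zero _).2 (LinearMap.ext fun g => X.eq_of_res_eq fun x hx => ?_)
    obtain ⟨W, hW, hxW, extend⟩ := exists_extension hX hV hx
    obtain ⟨G, hG⟩ := extend g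
    refine ⟨W, hW, hxW, ?_⟩
    rw [← Φ.restricts hV hW g, ← hG, Φ.restricts le_rfl (hW.trans hV) G,
      (mem_orderLT_zero _).1 hΦ]
    simp
  | succ k ih =>
    refine (mem_orderLT_succ _).2 fun f => mem_orderLT_of_locally fun x hx => ?_
    obtain ⟨W, hW, hxW, extend⟩ := exists_extension hX hV hx
    obtain ⟨F, hF⟩ := extend f
    have bracket_mem : (Φ.bracketMul F).op U le_rfl ∈ orderLT (X.part U) k :=
      (mem_orderLT_succ _).1 hΦ _
    refine ⟨W, hW, hxW, _, ?_, ih _ bracket_mem W (hW.trans hV)⟩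
    change Restricts hW _ (Z2n.bracketMul _ (X.res (hW.trans hV) F) _)
    rw [hF]
    exact (Φ.restricts hV hW).bracketMul f

end LocalEnd

/-- The section `s` is locally the image under `D` of the local extensions to `U` of the section
`g`. -/
def IsLocalValue {U V : Opens X.carrier} (D : Module.End ℝ (X.Sec U)) (hV : V ≤ U)
    (g s : X.Sec V) : Prop :=
  ∀ (W : Opens X.carrier) (hW : W ≤ V) (G : X.Sec U),
    X.res (hW.trans hV) G = X.res hW g → X.res hW s = X.res (hW.trans hV) (D G)

namespace IsLocalValue

variable {U V : Opens X.carrier} {k : ℕ} {D : Module.End ℝ (X.Sec U)} {hV : V ≤ U}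
  {f g s t : X.Sec V}

theorem of_locally (hX : X.HasBumps) (hD : D ∈ orderLT (X.part U) k)
    (h : ∀ x ∈ V, ∃ (W : Opens X.carrier) (hW : W ≤ V), x ∈ W ∧ ∃ G : X.Sec U,
      X.res (hW.trans hV) G = X.res hW g ∧ X.res hW s = X.res (hW.trans hV) (D G)) :
    IsLocalValue D hV g s := by
  refine fun T hT G hG => X.eq_of_res_eq fun x hx => ?_
  obtain ⟨W, hW, hxW, G', hG', hs⟩ := h x (hT hx)
  refine ⟨T ⊓ W, inf_le_left, ⟨hx, hxW⟩, ?_⟩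
  rw [res_res, res_res, ← X.res_res hW inf_le_right, hs, res_res]
  refine res_apply_congr hX _ hD ?_
  rw [← X.res_res (hW.trans hV) inf_le_right, hG', ← X.res_res (hT.trans hV) inf_le_left, hG,
    res_res, res_res]

theorem unique (hX : X.HasBumps) (hs : IsLocalValue D hV g s) (ht : IsLocalValue D hV g t) :
    s = t := by
  refine X.eq_of_res_eq fun x hx => ?_
  obtain ⟨W, hW, hxW, extend⟩ := exists_extension hX hV hx
  obtain ⟨G, hG⟩ := extend g
  exact ⟨W, hW, hxW, (hs W hW G hG).trans (ht W hW G hG).symm⟩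

theorem exists_isLocalValue (hX : X.HasBumps) (hD : D ∈ orderLT (X.part U) k) (hV : V ≤ U)
    (g : X.Sec V) : ∃ s, IsLocalValue D hV g s := by
  choose W hW hxW extend using fun x : V => exists_extension hX hV x.2
  choose G hG using fun x => extend x g
  obtain ⟨s, hs⟩ := X.exists_glue W hW (fun x hx => ⟨⟨x, hx⟩, hxW ⟨x, hx⟩⟩)
    (fun x => X.res ((hW x).trans hV) (D (G x))) fun x y => by
      rw [res_res, res_res]
      refine res_apply_congr hX _ hD ?_
      rw [← X.res_res ((hW x).trans hV) inf_le_left, hG,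
        ← X.res_res ((hW y).trans hV) inf_le_right, hG, res_res, res_res]
  exact ⟨s, of_locally hX hD fun x hx =>
    ⟨W ⟨x, hx⟩, hW ⟨x, hx⟩, hxW ⟨x, hx⟩, G ⟨x, hx⟩, hG ⟨x, hx⟩, hs ⟨x, hx⟩⟩⟩

theorem add (hX : X.HasBumps) (hD : D ∈ orderLT (X.part U) k) (hs : IsLocalValue D hV f s)
    (ht : IsLocalValue D hV g t) : IsLocalValue D hV (f + g) (s + t) := by
  refine of_locally hX hD fun x hx => ?_
  obtain ⟨W, hW, hxW, extend⟩ := exists_extension hX hV hx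
  obtain ⟨F, hF⟩ := extend f
  obtain ⟨G, hG⟩ := extend g
  refine ⟨W, hW, hxW, F + G, by rw [map_add, map_add, hF, hG], ?_⟩
  rw [map_add, map_add, map_add, hs W hW F hF, ht W hW G hG]

theorem smul (hX : X.HasBumps) (hD : D ∈ orderLT (X.part U) k) (r : ℝ)
    (hs : IsLocalValue D hV g s) : IsLocalValue D hV (r • g) (r • s) := by
  refine of_locally hX hD fun x hx => ?_
  obtain ⟨W, hW, hxW, extend⟩ := exists_extension hX hV hx
  obtain ⟨G, hG⟩ := extend g
  refine ⟨W, hW, hxW, r • G, by rw [map_smul, map_smul, hG], ?_⟩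
  rw [map_smul, map_smul, map_smul, hs W hW G hG]

theorem res (hs : IsLocalValue D hV g s) {W : Opens X.carrier} (hW : W ≤ V) :
    IsLocalValue D (hW.trans hV) (X.res hW g) (X.res hW s) := by
  intro T hT G hG
  rw [res_res] at hG ⊢
  exact hs T (hT.trans hW) G hG

end IsLocalValue

theorem exists_localEnd (hX : X.HasBumps) {U : Opens X.carrier} {k : ℕ}
    {D : Module.End ℝ (X.Sec U)} (hD : D ∈ orderLT (X.part U) k) :
    ∃ Φ : LocalEnd U, Φ.op U le_rfl = D := by
  choose φ hφ using fun V (hV : V ≤ U) (g : X.Sec V) =>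
    IsLocalValue.exists_isLocalValue hX hD hV g
  let Φ : LocalEnd U := {
    op := fun V hV =>
      { toFun := φ V hV
        map_add' := fun f g => (hφ V hV _).unique hX ((hφ V hV f).add hX hD (hφ V hV g))
        map_smul' := fun r g => (hφ V hV _).unique hX ((hφ V hV g).smul hX hD r) }
    restricts := fun hV hW g => (hφ _ (hW.trans hV) _).unique hX ((hφ _ hV g).res hW) }
  refine ⟨Φ, LinearMap.ext fun g => ?_⟩
  have apply_eq := hφ U le_rfl g U le_rfl g rfl
  rwa [res_self, res_self] at apply_eq

theorem exists_restricts (hX : X.HasBumps) {U V : Opens X.carrier} (h : V ≤ U) {k : ℕ}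
    {D : Module.End ℝ (X.Sec U)} (hD : D ∈ orderLT (X.part U) k) :
    ∃ D' : Module.End ℝ (X.Sec V), Restricts h D D' ∧ D' ∈ orderLT (X.part V) k := by
  obtain ⟨Φ, rfl⟩ := exists_localEnd hX hD
  exact ⟨Φ.op V h, Φ.restricts le_rfl h, Φ.op_mem_orderLT hX hD V h⟩

end LocalEnd

section Presheaf

variable {n : ℕ} {X : RingedSpace.{u} n} {k : ℕ}

theorem eq_of_restricts (hX : X.HasBumps) {U V : Opens X.carrier} {h : V ≤ U}
    {D : Module.End ℝ (X.Sec U)} {D' D'' : X.diffOp k V} (h' : Restricts h D D'.1)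
    (h'' : Restricts h D D''.1) : D' = D'' :=
  Subtype.ext (h'.unique hX h'' ((isDiffOp_iff_mem_orderLT _).1 D'.2)
    ((isDiffOp_iff_mem_orderLT _).1 D''.2))

/-- The restriction of a differential operator. -/
def diffOpRes (hX : X.HasBumps) {U V : Opens X.carrier} (h : V ≤ U) (D : X.diffOp k U) :
    X.diffOp k V :=
  have exists_res := exists_restricts hX h ((isDiffOp_iff_mem_orderLT _).1 D.2)
  ⟨exists_res.choose, (isDiffOp_iff_mem_orderLT _).2 exists_res.choose_spec.2⟩

theorem restricts_diffOpRes (hX : X.HasBumps) {U V : Opens X.carrier} (h : V ≤ U)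
    (D : X.diffOp k U) : Restricts h D.1 (diffOpRes hX h D).1 :=
  (exists_restricts hX h ((isDiffOp_iff_mem_orderLT _).1 D.2)).choose_spec.1

theorem diffOpRes_eq (hX : X.HasBumps) {U V : Opens X.carrier} {h : V ≤ U} {D : X.diffOp k U}
    {D' : X.diffOp k V} (h' : Restricts h D.1 D'.1) : diffOpRes hX h D = D' :=
  eq_of_restricts hX (restricts_diffOpRes hX h D) h'

/-- The presheaf of differential operators of order `k`. -/
def diffOpPresheaf (hX : X.HasBumps) (k : ℕ) : X.DiffOpPresheaf k where
  res h := AddMonoidHom.mk' (diffOpRes hX h) fun D E => diffOpRes_eq hX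
    ((restricts_diffOpRes hX h D).add (restricts_diffOpRes hX h E))
  res_apply h D g := restricts_diffOpRes hX h D g
  res_smul h f D := diffOpRes_eq hX ((restricts_diffOpRes hX h D).smul f)
  res_mem_part h _ D hD := (restricts_diffOpRes hX h D).mem_endHomogeneous hX
    ((isDiffOp_iff_mem_orderLT _).1 (diffOpRes hX h D).2) hD
  res_self U D := diffOpRes_eq hX fun g => by rw [X.res_self, X.res_self]
  res_res h h' D := (diffOpRes_eq hX
    ((restricts_diffOpRes hX h D).trans (restricts_diffOpRes hX h' _))).symm

theorem exists_end_restricts {ι : Type*} (U : ι → Opens X.carrier)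
    (D : ∀ i, Module.End ℝ (X.Sec (U i)))
    (hD : ∀ (i j) (g : X.Sec (iSup U)),
      X.res (inf_le_left : U i ⊓ U j ≤ U i) (D i (X.res (le_iSup U i) g)) =
        X.res inf_le_right (D j (X.res (le_iSup U j) g))) :
    ∃ E : Module.End ℝ (X.Sec (iSup U)), ∀ i, Restricts (le_iSup U i) E (D i) := by
  choose E hE using fun g => X.exists_glue U (le_iSup U) (fun x hx => Opens.mem_iSup.1 hx)
    (fun i => D i (X.res (le_iSup U i) g)) fun i j => hD i j g
  have ext_cover {f g : X.Sec (iSup U)}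
      (h : ∀ i, X.res (le_iSup U i) f = X.res (le_iSup U i) g) : f = g :=
    X.eq_of_res_eq fun x hx =>
      let ⟨i, hi⟩ := Opens.mem_iSup.1 hx
      ⟨U i, le_iSup U i, hi, h i⟩
  exact ⟨{
    toFun := E
    map_add' := fun f g => ext_cover fun i => by rw [hE, map_add, map_add, map_add, hE, hE]
    map_smul' := fun r f => ext_cover fun i => by
      rw [hE, map_smul, map_smul, RingHom.id_apply, map_smul, hE] }, fun i g => (hE g i).symm⟩

namespace DiffOpPresheaf

theorem restricts (F : X.DiffOpPresheaf k) {U V : Opens X.carrier} (h : V ≤ U)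
    (D : X.diffOp k U) : Restricts h D.1 (F.res h D).1 :=
  F.res_apply h D

theorem eq (hX : X.HasBumps) (F F' : X.DiffOpPresheaf k) : F = F' := by
  have res_eq : @F.res = @F'.res := by
    funext U V h
    exact AddMonoidHom.ext fun D => eq_of_restricts hX (F.restricts h D) (F'.restricts h D)
  cases F
  cases F'
  cases res_eq
  rfl

theorem exists_glue (F : X.DiffOpPresheaf k) {ι : Type*} (U : ι → Opens X.carrier)
    (D : ∀ i, X.diffOp k (U i))
    (hD : ∀ i j, F.res (inf_le_left : U i ⊓ U j ≤ U i) (D i) = F.res inf_le_right (D j)) :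
    ∃ E : X.diffOp k (iSup U), ∀ i, Restricts (le_iSup U i) E.1 (D i).1 := by
  obtain ⟨E, hE⟩ := exists_end_restricts U (fun i => (D i).1) fun i j g => by
    rw [← F.res_apply, ← F.res_apply, hD, X.res_res, X.res_res]
  refine ⟨⟨E, (isDiffOp_iff_mem_orderLT _).2 (mem_orderLT_of_locally fun x hx => ?_)⟩, hE⟩
  obtain ⟨i, hi⟩ := Opens.mem_iSup.1 hx
  exact ⟨U i, le_iSup U i, hi, (D i).1, hE i, (isDiffOp_iff_mem_orderLT _).1 (D i).2⟩

theorem isSheaf (hX : X.HasBumps) (F : X.DiffOpPresheaf k) : F.toPresheaf.IsSheaf := by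
  rw [TopCat.Presheaf.isSheaf_iff_isSheaf_comp (forget AddCommGrpCat.{u})]
  refine TopCat.Presheaf.isSheaf_of_isSheafUniqueGluing_types _ fun ι U D hD => ?_
  obtain ⟨E, hE⟩ := F.exists_glue U D hD
  refine ⟨E, fun i => eq_of_restricts hX (F.restricts _ E) (hE i), fun E' hE' => ?_⟩
  refine Subtype.ext (LinearMap.ext fun g => X.eq_of_res_eq fun x hx => ?_)
  obtain ⟨i, hi⟩ := Opens.mem_iSup.1 hx
  have res_E' : F.res (le_iSup U i) E' = D i := hE' i
  refine ⟨U i, le_iSup U i, hi, ?_⟩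
  rw [← hE i g, ← F.restricts (le_iSup U i) E' g, res_E']

end DiffOpPresheaf

end Presheaf

end RingedSpace

/-! ### Charts -/

section BumpFunctions

theorem exists_bump_of_openPartialHomeomorph {M E : Type*} [TopologicalSpace M] [T2Space M]
    [NormedAddCommGroup E] [NormedSpace ℝ E] [FiniteDimensional ℝ E]
    (φ : OpenPartialHomeomorph M E) {V : Opens M} (hV : (V : Set M) ⊆ φ.source) {x : M}
    (hx : x ∈ V) :
    ∃ (f : E → ℝ) (W C : Opens M), ContDiff ℝ ∞ f ∧ x ∈ W ∧ W ≤ V ∧ V ⊔ C = ⊤ ∧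
      (∀ z ∈ W, f (φ z) = 1) ∧ ∀ z ∈ V, z ∈ C → f (φ z) = 0 := by
  obtain ⟨ε, hε, closedBall_subset⟩ := Metric.nhds_basis_closedBall.mem_iff.1
    ((φ.isOpen_image_of_subset_source V.isOpen hV).mem_nhds (Set.mem_image_of_mem φ hx))
  let ψ : ContDiffBump (φ x) := ⟨ε / 2, ε, half_pos hε, half_lt_self hε⟩
  have closedBall_subset_target : Metric.closedBall (φ x) ε ⊆ φ.target :=
    closedBall_subset.trans ((Set.image_mono hV).trans φ.image_source_eq_target.subset)
  have mem_of_mem_closedBall {z : M} (hz : z ∈ φ.source) (h : φ z ∈ Metric.closedBall (φ x) ε) :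
      z ∈ V := by
    obtain ⟨w, hw, hwz⟩ := closedBall_subset h
    rwa [← φ.injOn (hV hw) hz hwz]
  have isCompact_preimage : IsCompact (φ.symm '' Metric.closedBall (φ x) ε) :=
    (isCompact_closedBall _ _).image_of_continuousOn
      (φ.continuousOn_symm.mono closedBall_subset_target)
  refine ⟨ψ, ⟨_, φ.isOpen_inter_preimage (Metric.isOpen_ball (x := φ x) (ε := ε / 2))⟩,
    ⟨_, isCompact_preimage.isClosed.isOpen_compl⟩, ψ.contDiff,
    ⟨hV hx, Metric.mem_ball_self (half_pos hε)⟩,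
    fun z hz => mem_of_mem_closedBall hz.1
      (Metric.ball_subset_closedBall (Metric.ball_subset_ball (half_le_self hε.le) hz.2)),
    eq_top_iff.2 fun z _ => or_iff_not_imp_left.2 fun hzV => ?_,
    fun z hz => ψ.one_of_mem_closedBall (Metric.ball_subset_closedBall hz.2),
    fun z hzV hzC => ψ.zero_of_le_dist (le_of_not_ge fun hd => hzC ?_)⟩
  · rintro ⟨y, hy, rfl⟩
    have hyt := closedBall_subset_target hy
    exact hzV (mem_of_mem_closedBall (φ.map_target hyt) (by rwa [φ.right_inv hyt]))
  · exact ⟨φ z, hd, φ.left_inv (hV hzV)⟩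

theorem domainRes_const {n p : ℕ} {q : {γ : Deg n // γ ≠ 0} → ℕ} {V W : Opens (Base p)}
    (h : W ≤ V) (f : Smooth V) :
    domainRes q h (Series.const f) = Series.const (smoothRes h f) :=
  Series.mapCoeff_const _ _

theorem RingedSpace.hasBumps_of_exists_chart {n p : ℕ} {q : {γ : Deg n // γ ≠ 0} → ℕ}
    {X : RingedSpace.{u} n} [T2Space X.carrier]
    (hc : ∀ x : X.carrier, ∃ c : X.Chart p q, x ∈ c.φ.source) : X.HasBumps := by
  intro U x hxU
  obtain ⟨c, hxc⟩ := hc x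
  have hV : ((U ⊓ c.source : Opens X.carrier) : Set X.carrier) ⊆ c.φ.source := fun y hy => hy.2
  set V : Opens X.carrier := U ⊓ c.source
  obtain ⟨b, W, C, hb, hxW, hWV, hVC, b_eq_one, b_eq_zero⟩ :=
    exists_bump_of_openPartialHomeomorph c.φ hV (x := x) ⟨hxU, hxc⟩
  let β : Smooth (imageOpens c.φ V hV) := smoothOf _ b fun _ _ => hb.contDiffAt
  let s : X.Sec V := (c.equiv V hV).symm (Series.const β)
  have equiv_res_s {T : Opens X.carrier} (hT : T ≤ V) :
      c.equiv T (Set.Subset.trans hT hV) (X.res hT s) =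
        Series.const (smoothRes (imageOpens_mono hV hT) β) := by
    rw [c.equiv_res hV hT, AlgEquiv.apply_symm_apply, domainRes_const]
  have res_s_eq_zero : X.res (inf_le_left : V ⊓ C ≤ V) s = 0 := by
    apply (c.equiv (V ⊓ C) (Set.Subset.trans inf_le_left hV)).injective
    rw [equiv_res_s, map_zero, ← map_zero Series.const]
    congr 1
    ext ⟨_, z, hz, rfl⟩
    exact b_eq_zero z hz.1 hz.2
  have res_s_eq_one : X.res hWV s = 1 := by
    apply (c.equiv W (Set.Subset.trans hWV hV)).injective
    rw [equiv_res_s, map_one, ← Series.const_one]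
    congr 1
    ext ⟨_, z, hz, rfl⟩
    exact b_eq_one z hz
  obtain ⟨ρ, hρV, hρC⟩ := X.exists_extension_by_zero hVC s res_s_eq_zero
  refine ⟨ρ, X.mem_part_of_locally fun z _ => ?_, W, C, hxW, hWV.trans inf_le_left,
    top_unique (hVC.ge.trans (sup_le_sup_right inf_le_left C)), ?_, hρC⟩
  · rcases hVC.ge (Opens.mem_top z) with hz | hz
    · refine ⟨V, le_top, hz, ?_⟩
      rw [hρV, ← c.equiv_mem_homogeneous V hV, AlgEquiv.apply_symm_apply]
      exact Series.const_mem β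
    · exact ⟨C, le_top, hz, hρC ▸ Submodule.zero_mem _⟩
  · rw [← X.res_res le_top hWV, hρV, res_s_eq_one]

end BumpFunctions

section Transport

variable {A B : Type*} [Ring A] [Algebra ℝ A] [Ring B] [Algebra ℝ B]

/-- Transport of operators along an isomorphism of algebras. -/
def conjEnd (ε : A ≃ₐ[ℝ] B) : Module.End ℝ B →* Module.End ℝ A where
  toFun D := ε.symm.toLinearMap ∘ₗ D ∘ₗ ε.toLinearMap
  map_one' := by ext; simp
  map_mul' D E := by ext; simp

theorem conjEnd_apply (ε : A ≃ₐ[ℝ] B) (D : Module.End ℝ B) (f : A) :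
    conjEnd ε D f = ε.symm (D (ε f)) := rfl

variable {n : ℕ} {𝒜 : Deg n → Submodule ℝ A} {ℬ : Deg n → Submodule ℝ B} {ι : Type*}
  [DecidableEq ι] {d : ι → Deg n}

theorem conjEnd_mem_endHomogeneous {ε : A ≃ₐ[ℝ] B} (hε : ∀ γ f, ε f ∈ ℬ γ ↔ f ∈ 𝒜 γ)
    {γ : Deg n} {D : Module.End ℝ B} (hD : D ∈ endHomogeneous ℬ γ) :
    conjEnd ε D ∈ endHomogeneous 𝒜 γ := by
  intro δ f hf
  rw [← hε, conjEnd_apply, AlgEquiv.apply_symm_apply]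
  exact hD δ _ ((hε δ f).2 hf)

namespace GradedCoordinates

/-- The coordinates that correspond to given ones under an isomorphism of graded algebras. -/
def comap (C : GradedCoordinates ℬ d) (ε : A ≃ₐ[ℝ] B) (hε : ∀ γ f, ε f ∈ ℬ γ ↔ f ∈ 𝒜 γ) :
    GradedCoordinates 𝒜 d where
  coord a := ε.symm (C.coord a)
  pderiv a := conjEnd ε (C.pderiv a)
  coord_mem a := by
    rw [← hε, AlgEquiv.apply_symm_apply]
    exact C.coord_mem a
  pderiv_mem a := conjEnd_mem_endHomogeneous hε (C.pderiv_mem a)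
  leibniz a φ f hf g := by
    apply ε.injective
    simp only [conjEnd_apply, map_add, map_mul, map_smul, AlgEquiv.apply_symm_apply]
    exact C.leibniz a φ _ ((hε φ f).2 hf) _
  pderiv_coord a b := by
    rw [conjEnd_apply, AlgEquiv.apply_symm_apply, C.pderiv_coord, apply_ite ε.symm, map_one,
      map_zero]
  rigid γ E hE E_coord_mul E_one := by
    have conj_eq_zero : conjEnd ε.symm E = 0 := by
      refine C.rigid γ _ (conjEnd_mem_endHomogeneous (fun γ f => ?_) hE) (fun a f => ?_) ?_
      · rw [← hε, AlgEquiv.apply_symm_apply]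
      · simp only [conjEnd_apply, AlgEquiv.symm_symm]
        rw [map_mul, E_coord_mul, map_smul, map_mul, AlgEquiv.apply_symm_apply]
      · rw [conjEnd_apply, map_one, E_one, map_zero]
    ext f
    apply ε.injective
    simpa [conjEnd_apply] using LinearMap.congr_fun conj_eq_zero (ε f)

theorem comap_diff (C : GradedCoordinates ℬ d) (ε : A ≃ₐ[ℝ] B)
    (hε : ∀ γ f, ε f ∈ ℬ γ ↔ f ∈ 𝒜 γ) (L : List ι) (i : ι → ℕ) :
    (C.comap ε hε).diff L i = conjEnd ε (C.diff L i) := by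
  simp only [diff, comap, map_list_prod, List.map_map, Function.comp_def, map_pow]

end GradedCoordinates

end Transport

theorem apply_list_prod_pow_of_intertwining {R M N ι : Type*} [Semiring R] [AddCommMonoid M]
    [Module R M] [AddCommMonoid N] [Module R N] {φ : M →ₗ[R] N} {D : ι → Module.End R M}
    {E : ι → Module.End R N} (h : ∀ a f, φ (D a f) = E a (φ f)) (m : ι → ℕ) (L : List ι) (f : M) :
    φ ((L.map fun a => D a ^ m a).prod f) = (L.map fun a => E a ^ m a).prod (φ f) := by
  induction L with
  | nil => rfl
  | cons a L ih =>
    have pow_intertwines : (E a ^ m a) ∘ₗ φ = φ ∘ₗ (D a ^ m a) :=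
      Module.End.commute_pow_left_of_commute (LinearMap.ext fun f => (h a f).symm) (m a)
    simp only [List.map_cons, List.prod_cons, Module.End.mul_apply]
    rw [← ih]
    exact (LinearMap.congr_fun pow_intertwines _).symm

section Domain

variable {n p k : ℕ} {q : {γ : Deg n // γ ≠ 0} → ℕ}

/-- The coordinates of the domain `ℝ^{p|q}`: those of degree zero, followed by the formal ones. -/
abbrev CoordVar (p : ℕ) (q : {γ : Deg n // γ ≠ 0} → ℕ) : Type := Fin p ⊕ FormalVar q

/-- The degree of a coordinate of `ℝ^{p|q}`. -/
def coordDeg : CoordVar p q → Deg n := Sum.elim (fun _ => 0) FormalVar.deg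

/-- The coordinates of `ℝ^{p|q}` in increasing order. -/
def coordList (p : ℕ) (q : {γ : Deg n // γ ≠ 0} → ℕ) : List (CoordVar p q) :=
  (List.finRange p).map Sum.inl ++
    ((Finset.univ : Finset (FormalVar q)).sort (· ≥ ·)).reverse.map Sum.inr

theorem nodup_coordList : (coordList p q).Nodup := by
  refine List.Nodup.append ((List.nodup_finRange p).map Sum.inl_injective)
    ((List.nodup_reverse.2 (Finset.sort_nodup _ _)).map Sum.inr_injective) ?_
  intro a ha hb
  obtain ⟨i, -, rfl⟩ := List.mem_map.1 ha
  obtain ⟨j, -, h⟩ := List.mem_map.1 hb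
  cases h

theorem mem_coordList (a : CoordVar p q) : a ∈ coordList p q := by
  rcases a with i | a
  · exact List.mem_append_left _ (List.mem_map_of_mem (List.mem_finRange i))
  · exact List.mem_append_right _ (List.mem_map_of_mem
      (List.mem_reverse.2 ((Finset.mem_sort _).2 (Finset.mem_univ a))))

namespace DerivIdx

/-- The exponents of all coordinates in an index `(α, (β, γ))`, as one function. -/
def exponent (i : DerivIdx p q k) : CoordVar p q → ℕ := Sum.elim i.1.1 i.1.2.1

theorem exponent_injective : Function.Injective (exponent (p := p) (q := q) (k := k)) := by
  rintro ⟨⟨α, β⟩, hi⟩ ⟨⟨α', β'⟩, hi'⟩ h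
  obtain rfl : α = α' := funext fun c => congrFun h (Sum.inl c)
  obtain rfl : β = β' := Subtype.ext (Finsupp.ext fun a => congrFun h (Sum.inr a))
  rfl

theorem exists_exponent_eq_iff (j : CoordVar p q → ℕ) :
    (∃ i : DerivIdx p q k, i.exponent = j) ↔
      (∀ a, IsOdd (coordDeg a) → j a ≤ 1) ∧ ∑ a, j a ≤ k := by
  rw [Fintype.sum_sum_type]
  constructor
  · rintro ⟨⟨⟨α, β⟩, hi⟩, rfl⟩
    refine ⟨?_, hi⟩
    rintro (c | a) ha
    · simp [coordDeg, IsOdd, parity] at ha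
    · exact β.2 a ha
  · rintro ⟨hodd, hsum⟩
    refine ⟨⟨⟨fun c => j (Sum.inl c), ⟨Finsupp.equivFunOnFinite.symm fun a => j (Sum.inr a),
      fun a ha => hodd (Sum.inr a) ha⟩⟩, hsum⟩, ?_⟩
    funext a
    rcases a with c | a <;> rfl

theorem sum_exponent_le (i : DerivIdx p q k) : ∑ a, i.exponent a ≤ k :=
  ((exists_exponent_eq_iff _).1 ⟨i, rfl⟩).2

instance : Finite (DerivIdx p q k) :=
  have exponent_lt (i : DerivIdx p q k) (a : CoordVar p q) : i.exponent a < k + 1 :=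
    Nat.lt_succ_of_le
      ((Finset.single_le_sum (fun _ _ => Nat.zero_le _) (Finset.mem_univ a)).trans
        i.sum_exponent_le)
  Finite.of_injective
    (fun (i : DerivIdx p q k) (a : CoordVar p q) => (⟨i.exponent a, exponent_lt i a⟩ : Fin (k + 1)))
    fun _ _ h => exponent_injective (funext fun a => congrArg Fin.val (congrFun h a))

theorem deg_eq_sum (i : DerivIdx p q k) : i.deg = ∑ a, i.exponent a • (coordDeg a : Deg n) := by
  rw [Fintype.sum_sum_type]
  simp [exponent, coordDeg, deg, monDeg]

end DerivIdx

/-- The coordinates of `ℝ^{p|q}` and their partial derivatives over an open subset. -/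
def domainCoordinates (V : Opens (Base p)) :
    GradedCoordinates (Series.homogeneous (d := FormalVar.deg (q := q)) (R := Smooth V))
      (coordDeg (p := p) (q := q)) where
  coord := Sum.elim (fun i => Series.const (smoothCoord V i)) Series.var
  pderiv := Sum.elim (fun i => Series.mapCoeff (smoothDeriv i)) Series.formalDeriv
  coord_mem
    | .inl i => Series.const_mem _
    | .inr a => Series.var_mem a
  pderiv_mem
    | .inl i => fun δ f hf => (add_zero δ).symm ▸ Series.mapCoeff_mem _ hf
    | .inr a => fun _ _ hf => Series.formalDeriv_mem a hf
  leibniz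
    | .inl i => fun φ f _ g => by
      change Series.mapCoeff _ _ = _ + sgn 0 φ • _
      rw [sgn_zero_left, one_smul]
      exact Series.mapCoeff_leibniz (smoothDeriv_mul i) f g
    | .inr a => fun _ _ hf g => Series.formalDeriv_leibniz a hf g
  pderiv_coord
    | .inl i, .inl j => by
      simp only [Sum.elim_inl, Sum.inl.injEq]
      rw [Series.mapCoeff_const, smoothDeriv_smoothCoord, apply_ite Series.const, map_zero,
        Series.const_one]
    | .inl i, .inr b => by simpa using Series.mapCoeff_var (smoothDeriv_one i) b
    | .inr a, .inl j => by simpa using Series.formalDeriv_const a (smoothCoord V j)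
    | .inr a, .inr b => by simpa using Series.formalDeriv_var a b
  rigid γ E _ E_coord_mul E_one :=
    domain_end_eq_zero (fun a => ⟨_, E_coord_mul (.inr a)⟩)
      (fun i f => by
        have E_coord_mul := E_coord_mul (.inl i) f
        change _ = sgn γ 0 • _ at E_coord_mul
        rwa [sgn_zero_right, one_smul] at E_coord_mul)
      E_one

theorem domainDeriv_eq_diff (V : Opens (Base p)) (i : DerivIdx p q k) :
    domainDeriv V i = (domainCoordinates V).diff (coordList p q) i.exponent := by
  simp only [GradedCoordinates.diff, coordList, List.reverse_append, ← List.map_reverse,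
    List.reverse_reverse, List.map_append, List.map_map, List.prod_append]
  rfl

theorem domainRes_domainDeriv {V W : Opens (Base p)} (h : W ≤ V) (i : DerivIdx p q k)
    (f : DomainSections q V) :
    domainRes q h (domainDeriv V i f) = domainDeriv W i (domainRes q h f) := by
  rw [domainDeriv_eq_diff, domainDeriv_eq_diff]
  refine apply_list_prod_pow_of_intertwining ?_ _ _ f
  rintro (c | a) f
  · refine Series.ext fun α _ => ?_
    simp only [domainCoordinates, Sum.elim_inl, domainRes, Series.coeff_mapCoeff,
      smoothRes_smoothDeriv]
  · exact Series.mapCoeff_formalDeriv _ a f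

end Domain

namespace RingedSpace

variable {n p k : ℕ} {q : {γ : Deg n // γ ≠ 0} → ℕ} {X : RingedSpace.{u} n}

theorem isGradedDiffOp (k : ℕ) (U : Opens X.carrier) : X.IsGradedDiffOp k U where
  isInternal := isInternal_diffOp (X.graded_comm U) k
  smul_mem γ δ f hf D hD ε a ha := by
    have := SetLike.mul_mem_graded hf (hD ε a ha)
    rwa [add_left_comm] at this

namespace Chart

variable (c : X.Chart p q) {W : Opens X.carrier} (hW : W ≤ c.source)

/-- The coordinates of a chart over an open subset of its domain. -/
def gradedCoordinates : GradedCoordinates (X.part W) (coordDeg (p := p) (q := q)) :=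
  (domainCoordinates _).comap (c.equiv W hW) (c.equiv_mem_homogeneous W hW)

theorem deriv_eq_diff (i : DerivIdx p q k) :
    c.deriv W hW i = (c.gradedCoordinates hW).diff (coordList p q) i.exponent := by
  rw [gradedCoordinates, GradedCoordinates.comap_diff, ← domainDeriv_eq_diff]
  rfl

theorem deriv_mem_orderLT (i : DerivIdx p q k) : c.deriv W hW i ∈ orderLT (X.part W) (k + 1) := by
  rw [deriv_eq_diff]
  refine orderLT_mono _ (Nat.succ_le_succ ?_)
    ((c.gradedCoordinates hW).diff_mem_orderLT (X.graded_comm W) _ _)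
  rw [list_sum_map_eq_sum nodup_coordList mem_coordList]
  exact i.sum_exponent_le

theorem deriv_mem_endHomogeneous (i : DerivIdx p q k) :
    c.deriv W hW i ∈ endHomogeneous (X.part W) i.deg := by
  rw [deriv_eq_diff, DerivIdx.deg_eq_sum, ← list_sum_map_eq_sum nodup_coordList mem_coordList]
  exact (c.gradedCoordinates hW).diff_mem_endHomogeneous _ _

theorem restricts_deriv (i : DerivIdx p q k) :
    Restricts hW (c.deriv c.source le_rfl i) (c.deriv W hW i) := by
  intro g
  apply (c.equiv W hW).injective
  simp only [deriv, LinearMap.comp_apply, AlgEquiv.toLinearMap_apply]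
  rw [AlgEquiv.apply_symm_apply, c.equiv_res (W := c.source) subset_rfl hW,
    c.equiv_res (W := c.source) subset_rfl hW, AlgEquiv.apply_symm_apply, domainRes_domainDeriv]

/-- The operator `∂_ζ^γ ∂_θ^β ∂_x^α` as an element of `D^k` of the domain of the chart. -/
def derivDiffOp (i : DerivIdx p q k) : X.diffOp k c.source :=
  ⟨c.deriv c.source le_rfl i, (isDiffOp_iff_mem_orderLT _).2 (c.deriv_mem_orderLT le_rfl i)⟩

theorem res_derivDiffOp (hX : X.HasBumps) (F : X.DiffOpPresheaf k) (i : DerivIdx p q k) :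
    (F.res hW (c.derivDiffOp i) : Module.End ℝ (X.Sec W)) = c.deriv W hW i :=
  (F.restricts hW (c.derivDiffOp i)).unique hX (c.restricts_deriv hW i)
    ((isDiffOp_iff_mem_orderLT _).1 (F.res hW _).2) (c.deriv_mem_orderLT hW i)

theorem isLocalBasis (hX : X.HasBumps) (F : X.DiffOpPresheaf k) :
    F.IsLocalBasis c.source DerivIdx.deg c.derivDiffOp :=
  ⟨fun i => c.deriv_mem_endHomogeneous le_rfl i, fun _ hW =>
    (c.gradedCoordinates hW).exists_basis (X.graded_comm _) nodup_coordList mem_coordList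
      DerivIdx.exponent_injective DerivIdx.exists_exponent_eq_iff
      (fun i => F.res hW (c.derivDiffOp i))
      fun i => by rw [c.res_derivDiffOp hW hX F i, deriv_eq_diff]⟩

end Chart

end RingedSpace

end Z2n

end

theorem theorem4p5_general {n p : ℕ} (q : {γ : Z2n.Deg n // γ ≠ 0} → ℕ) (X : Z2n.RingedSpace.{u} n)
    [T2Space X.carrier] (exists_chart : ∀ x : X.carrier, ∃ c : X.Chart p q, x ∈ c.φ.source)
    (k : ℕ) :
    (∀ U, X.IsGradedDiffOp k U) ∧
    ∃ F : X.DiffOpPresheaf k, (∀ F' : X.DiffOpPresheaf k, F' = F) ∧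
      F.toPresheaf.IsSheaf ∧
      F.IsLocallyFree ∧
      ∀ c : X.Chart p q, ∃ e : Z2n.DerivIdx p q k → X.diffOp k c.source,
        (∀ W (h : W ≤ c.source) i, (F.res h (e i) : Module.End ℝ (X.Sec W)) = c.deriv W h i) ∧
        F.IsLocalBasis c.source Z2n.DerivIdx.deg e := by
  have hb := Z2n.RingedSpace.hasBumps_of_exists_chart exists_chart
  let F := Z2n.RingedSpace.diffOpPresheaf hb k
  refine ⟨Z2n.RingedSpace.isGradedDiffOp k, F, fun F' => F'.eq hb F, F.isSheaf hb, fun x => ?_,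
    fun c => ⟨c.derivDiffOp, fun W h i => c.res_derivDiffOp h hb F i, c.isLocalBasis hb F⟩⟩
  obtain ⟨c, hc⟩ := exists_chart x
  exact ⟨c.source, hc, Z2n.DerivIdx p q k, inferInstance, _, _, c.isLocalBasis hb F⟩

theorem theorem4p5 {n p : ℕ} (q : {γ : Z2n.Deg n // γ ≠ 0} → ℕ) (X : Z2n.RingedSpace.{u} n)
    (hX : X.IsManifold p q) (k : ℕ) :
    -- the differential operators over any open subset form a graded module
    (∀ U, X.IsGradedDiffOp k U) ∧
    -- there is exactly one presheaf structure for which restriction of operators is compatible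
    -- with restriction of functions
    ∃ F : X.DiffOpPresheaf k, (∀ F' : X.DiffOpPresheaf k, F' = F) ∧
      -- it is a sheaf
      F.toPresheaf.IsSheaf ∧
      -- it is locally free
      F.IsLocallyFree ∧
      -- the coordinate operators of any chart, over any open subset of its domain, form a basis
      ∀ c : X.Chart p q, ∃ e : Z2n.DerivIdx p q k → X.diffOp k c.source,
        (∀ W (h : W ≤ c.source) i, (F.res h (e i) : Module.End ℝ (X.Sec W)) = c.deriv W h i) ∧
        F.IsLocalBasis c.source Z2n.DerivIdx.deg e := by
  have := hX.t2
  exact theorem4p5_general q X hX.exists_chart k
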